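/- Let $\mathcal E_s>0$. Consider a discrete-time channel with real-valued inputs $x_1,x_2,\dots$ and outputs $y_1,y_2,\dots$, with arbitrary memory (the law of the output sequence is an arbitrary probability kernel of the input sequence). Under i.i.d. $\mathcal N(0,\mathcal E_s)$ input let the joint input/output process be stationary and ergodic, also when it is viewed in super-symbols: for every $L\ge 1$ the shift by $L$ channel uses preserves the joint law of $((x_k),(y_k))$ and is ergodic for it. For $L\ge1$ let $\underline x_k,\underline y_k\in\mathbb R^L$ be the $k$-th consecutive length-$L$ blocks (super-symbols) of input and output, and $\underline x,\underline y$ the first ones. For a Borel map $g:\mathbb R^L\to\mathbb R^L$ with $\mathbf E\|g(\underline y)\|^2<\infty$ and $a\in\mathbb R$, the decoder chooses, after $n$ super-symbols, the message $m$ minimizing $$D_g(m)=\frac1n\sum_{k=1}^n\|g(\underline y_k)-a\,\underline x_k(m)\|^2 ,$$ where an error is counted unless the transmitted message is the unique minimizer. The codewords are drawn independently, each i.i.d. $\mathcal N(0,\mathcal E_s)$. Let $I_{\mathrm{GMI},L,g,a}\in[0,\infty]$ be the generalized mutual information per channel use in nats: the supremum of all $R\ge0$ such that, with $\lceil e^{nLR}\rceil$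 equally likely messages, the error probability averaged over the codebook ensemble tends to $0$ as $n\to\infty$. Put $$\Delta_{L,g}=\frac{\{\mathbf E[\underline x^{t}g(\underline y)]\}^2}{L\,\mathcal E_s\,\mathbf E[\|g(\underline y)\|^2]}\quad(\text{read as }0\text{ if }g(\underline y)=0\text{ a.s.}),\qquad \mathrm{mmse}_L=\frac1L\mathbf E\big[\|\underline x-\mathbf E[\underline x|\underline y]\|^2\big].$$ Below, $\frac12\log(1+p/q)$ is $+\infty$ when $p>0=q$. Then for every $L\ge1$: 1. For every such $g$, $I_{\mathrm{GMI},L,g,a}$ is maximized over $a\in\mathbb R$ by $a_{\mathrm{opt}}=\mathbf E[\underline x^{t}g(\underline y)]/(L\mathcal E_s)$, and $\max_a I_{\mathrm{GMI},L,g,a}=\frac12\log\big(1+\frac{\Delta_{L,g}}{1-\Delta_{L,g}}\big)$. 2. A Borel map $g_{\mathrm{opt}}$ with $g_{\mathrm{opt}}(\underline y)=\mathbf E[\underline x|\underline y]$ a.s. exists. Each such map satisfies $\mathbf E\|g_{\mathrm{opt}}(\underline y)\|^2<\infty$, maximizes $\Delta_{L,g}$ over all $g$ as above, with maximum $\mathrm{tr}[\mathrm{cov}\,\mathbf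 E[\underline x|\underline y]]/(L\mathcal E_s)$, and with its $a_{\mathrm{opt}}$ attains $\sup_{g,a}I_{\mathrm{GMI},L,g,a}$; moreover $$\sup_{g,a}I_{\mathrm{GMI},L,g,a}=\frac12\log\Big(1+\frac{\mathcal E_s-\mathrm{mmse}_L}{\mathrm{mmse}_L}\Big).$$ Consequently, if $\mathrm{mmse}=\lim_{L\to\infty}\mathrm{mmse}_L$ exists, then $$\lim_{L\to\infty}\ \sup_{g,a}I_{\mathrm{GMI},L,g,a}=\frac12\log\Big(1+\frac{\mathcal E_s-\mathrm{mmse}}{\mathrm{mmse}}\Big).$$ -/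

import Mathlib

open MeasureTheory ProbabilityTheory Filter Topology
open scoped NNReal ENNReal

noncomputable section

/-- Real-valued sequences; the paper's time index `k = 1, 2, …` is `0, 1, …` here. -/
abbrev RSeq : Type := ℕ → ℝ

/-- Law of an i.i.d. Gaussian input sequence with mean zero and variance `Es`. -/
def inputLaw (Es : ℝ≥0) : Measure RSeq :=
  Measure.infinitePi (fun _ : ℕ => gaussianReal 0 Es)

/-- Joint law of input and output sequence. A channel (with arbitrary memory) is a Markov kernel
`W` that gives the law of the output sequence for each input sequence. -/
def jointLaw (Es : ℝ≥0) (W : Kernel RSeq RSeq) : Measure (RSeq × RSeq) :=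
  (inputLaw Es) ⊗ₘ W

/-- Time shift by one channel use of an input/output pair of sequences. -/
def pairShift (ω : RSeq × RSeq) : RSeq × RSeq :=
  (fun k => ω.1 (k + 1), fun k => ω.2 (k + 1))

/-- The `k`-th super-symbol of length `L` of a sequence. -/
def superSymbol (L k : ℕ) (x : RSeq) : Fin L → ℝ := fun l => x (k * L + l)

/-- The distance metric `(1/n) ∑_{k<n} ‖g(y_k) - a x_k‖²` over `n` super-symbols
(Euclidean norm). -/
def distMetric (L : ℕ) (g : (Fin L → ℝ) → (Fin L → ℝ)) (a : ℝ) (n : ℕ) (x y : RSeq) : ℝ :=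
  (1 / (n : ℝ)) * ∑ k ∈ Finset.range n, ∑ l : Fin L,
    (g (superSymbol L k y) l - a * superSymbol L k x l) ^ 2

/-- Probability of decoding error of the nearest-neighbour decoder after `n` super-symbols with
`M` messages, averaged over the messages and over the ensemble of codebooks `C` whose codewords are
independent with law `inputLaw Es`. When message `m` is sent, the output `y` has law `W (C m)`,
and decoding succeeds iff `m` is the unique minimizer of the distance metric. -/
def avgError (Es : ℝ≥0) (W : Kernel RSeq RSeq) (L : ℕ) (g : (Fin L → ℝ) → (Fin L → ℝ)) (a : ℝ)
    (n M : ℕ) : ℝ≥0∞ :=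
  (M : ℝ≥0∞)⁻¹ * ∑ m : Fin M,
    ∫⁻ C : Fin M → RSeq,
      W (C m) {y | ∃ m' : Fin M, m' ≠ m ∧ distMetric L g a n (C m') y ≤ distMetric L g a n (C m) y}
      ∂(Measure.pi (fun _ : Fin M => inputLaw Es))

/-- The rate `R`, in nats per channel use, is achievable for the random ensemble: with
`⌈exp (n L R)⌉` messages in `n` super-symbols (`n L` channel uses) the average error probability
vanishes. -/
def IsAchievable (Es : ℝ≥0) (W : Kernel RSeq RSeq) (L : ℕ) (g : (Fin L → ℝ) → (Fin L → ℝ))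
    (a R : ℝ) : Prop :=
  Tendsto (fun n : ℕ => avgError Es W L g a n ⌈Real.exp ((n : ℝ) * (L : ℝ) * R)⌉₊) atTop (𝓝 0)

/-- The GMI per channel use for given `L`, `g`, `a`: the supremum (possibly `⊤`) of the rates at
which the ensemble-average error probability of the nearest-neighbour decoder vanishes. -/
def gmi (Es : ℝ≥0) (W : Kernel RSeq RSeq) (L : ℕ) (g : (Fin L → ℝ) → (Fin L → ℝ)) (a : ℝ) :
    EReal :=
  sSup {r : EReal | ∃ R : ℝ, 0 ≤ R ∧ IsAchievable Es W L g a R ∧ r = (R : EReal)}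

/-- The mappings `g` to be optimized over: Borel, with `E‖g(y)‖² < ∞`. -/
def IsAdmissible (Es : ℝ≥0) (W : Kernel RSeq RSeq) (L : ℕ) (g : (Fin L → ℝ) → (Fin L → ℝ)) :
    Prop :=
  Measurable g ∧
    ∀ l : Fin L, MemLp (fun ω : RSeq × RSeq => g (superSymbol L 0 ω.2) l) 2 (jointLaw Es W)

/-- The GMI optimized over `g` (and over the scaling `a`). -/
def gmiOpt (Es : ℝ≥0) (W : Kernel RSeq RSeq) (L : ℕ) : EReal :=
  sSup {r : EReal | ∃ (g : (Fin L → ℝ) → (Fin L → ℝ)) (a : ℝ),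
    IsAdmissible Es W L g ∧ r = gmi Es W L g a}

/-- `E[xᵗ g(y)]`. -/
def crossCorr (Es : ℝ≥0) (W : Kernel RSeq RSeq) (L : ℕ) (g : (Fin L → ℝ) → (Fin L → ℝ)) : ℝ :=
  ∫ ω : RSeq × RSeq, ∑ l : Fin L, superSymbol L 0 ω.1 l * g (superSymbol L 0 ω.2) l
    ∂(jointLaw Es W)

/-- `E‖g(y)‖²`. -/
def outPower (Es : ℝ≥0) (W : Kernel RSeq RSeq) (L : ℕ) (g : (Fin L → ℝ) → (Fin L → ℝ)) : ℝ :=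
  ∫ ω : RSeq × RSeq, ∑ l : Fin L, (g (superSymbol L 0 ω.2) l) ^ 2 ∂(jointLaw Es W)

/-- The scaling `E[xᵗ g(y)] / (L Es)`. -/
def aOpt (Es : ℝ≥0) (W : Kernel RSeq RSeq) (L : ℕ) (g : (Fin L → ℝ) → (Fin L → ℝ)) : ℝ :=
  crossCorr Es W L g / ((L : ℝ) * (Es : ℝ))

/-- `Δ = E[xᵗ g(y)]² / (L Es E‖g(y)‖²)`, read as `0` if `g(y) = 0` almost surely. -/
def corrDelta (Es : ℝ≥0) (W : Kernel RSeq RSeq) (L : ℕ) (g : (Fin L → ℝ) → (Fin L → ℝ)) : ℝ :=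
  (crossCorr Es W L g) ^ 2 / ((L : ℝ) * (Es : ℝ) * outPower Es W L g)

/-- The sigma-algebra on the joint space generated by the first output super-symbol. -/
@[reducible] def outputSigma (L : ℕ) : MeasurableSpace (RSeq × RSeq) :=
  MeasurableSpace.comap (fun ω : RSeq × RSeq => superSymbol L 0 ω.2) inferInstance

/-- `E[x_l | y]`, the `l`-th coordinate of the conditional mean of the input super-symbol given
the output super-symbol. -/
def condMean (Es : ℝ≥0) (W : Kernel RSeq RSeq) (L : ℕ) (l : Fin L) : RSeq × RSeq → ℝ :=
  (jointLaw Es W)[fun ω : RSeq × RSeq => superSymbol L 0 ω.1 l | outputSigma L]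

/-- The normalized block MMSE `(1/L) E‖x - E[x|y]‖²`. -/
def blockMMSE (Es : ℝ≥0) (W : Kernel RSeq RSeq) (L : ℕ) : ℝ :=
  (1 / (L : ℝ)) * ∫ ω : RSeq × RSeq,
    ∑ l : Fin L, (superSymbol L 0 ω.1 l - condMean Es W L l ω) ^ 2 ∂(jointLaw Es W)

/-- `g` is a Borel version of `y ↦ E[x | y]`. -/
def IsMMSEEstimator (Es : ℝ≥0) (W : Kernel RSeq RSeq) (L : ℕ)
    (g : (Fin L → ℝ) → (Fin L → ℝ)) : Prop :=
  Measurable g ∧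
    ∀ l : Fin L, (fun ω : RSeq × RSeq => g (superSymbol L 0 ω.2) l)
      =ᵐ[jointLaw Es W] condMean Es W L l

/-- `½ log (1 + p / q)` for `p, q ≥ 0`, with value `⊤` for `q = 0 < p`. -/
def halfLogSNR (p q : ℝ) : EReal :=
  ((1 / 2 : ℝ) : EReal) * ENNReal.log (1 + ENNReal.ofReal p / ENNReal.ofReal q)

end

/-!
The law of large numbers for an ergodic process makes the empirical second moments of the word pair
(transmitted codeword, processed output) over `n` super-symbols converge in probability to
`G = E‖g(y)‖²`, `C = E[xᵗ g(y)]` and `L Es` (`tendsto_typicalSet_compl`). Only convergence in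
probability is needed, so von Neumann's mean ergodic theorem, extended from `L²` to `L¹` by density,
is enough (`tendsto_measure_birkhoffAverage_sub_gt`).

Given the transmitted codeword and the output, the competing codewords are independent, and each
one wins with the same probability `p`. Hence the average error probability with `k` competitors is
exactly `E[1 - (1 - p)ᵏ]` (`avgError_eq`): it vanishes when `k p → 0` on typical pairs, and it stays
away from zero when `k p → ∞` there. What remains is the exponential decay rate of `p` on typical
pairs, and both bounds for it come from one formula, the likelihood ratio of the codeword law
`N(0, Es)` with respect to a tilted law `N(m, s)` whose mean `m` is proportional to the processed
output (`pi_gaussianReal_eq_withDensity`).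

* Upper bound (`pi_gaussianReal_dist_le`): for a suitable tilt the likelihood ratio depends on the
  competitor only through its distance to the processed output, so it bounds `p` directly. At
  `a = C / (L Es)` the best tilt gives the exponent `½ log (1 / (1 - Δ))` per channel use, and an
  unbounded exponent if `Δ = 1`.
* Lower bound (`le_pi_gaussianReal_dist_le`): under the law with mean `(C / G) v`, where `v` is the
  processed output, and variance slightly below `(1 - Δ) Es`, the competitor has the same
  correlation with `v` as the transmitted codeword and slightly less energy. So it wins for every
  `a`, with probability close to one by Chebyshev, while the likelihood ratio is about
  `(1 - Δ)^(nL/2)`.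

Together they give the formula for the GMI (`gmi_aOpt`) and its optimality in `a` (`gmi_le`). The
optimization over `g` is Cauchy–Schwarz in `L²`: `E[xᵗ g(y)] = E[E[x|y]ᵗ g(y)]`, so `Δ` is largest
at `g(y) = E[x|y]`, where `1 - Δ = mmse_L / Es` (`corrDelta_le_condPower`, `blockMMSE_eq`).
-/

open MeasureTheory ProbabilityTheory Filter Topology
open scoped NNReal ENNReal

/-! ### The mean ergodic theorem in `L¹` -/

section Ergodic

variable {Ω : Type*} [MeasurableSpace Ω] {μ : Measure Ω} {T : Ω → Ω}

theorem coeFn_iterate_compMeasurePreserving (hT : MeasurePreserving T μ μ) (x : Lp ℝ 2 μ) (k : ℕ) :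
    ((Lp.compMeasurePreservingₗᵢ ℝ T hT)^[k] x : Lp ℝ 2 μ) =ᵐ[μ] fun ω => x (T^[k] ω) := by
  induction k with
  | zero => simp
  | succ k ih =>
    rw [Function.iterate_succ_apply']
    refine (Lp.coeFn_compMeasurePreserving _ hT).trans ?_
    refine (hT.quasiMeasurePreserving.ae_eq ih).trans ?_
    exact Eventually.of_forall fun ω => by simp

theorem coeFn_birkhoffAverage_compMeasurePreserving (hT : MeasurePreserving T μ μ)
    (x : Lp ℝ 2 μ) (n : ℕ) :
    (birkhoffAverage ℝ (Lp.compMeasurePreservingₗᵢ ℝ T hT) id n x : Lp ℝ 2 μ)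
      =ᵐ[μ] birkhoffAverage ℝ T x n := by
  refine (Lp.coeFn_smul _ _).trans ?_
  have h : (birkhoffSum (Lp.compMeasurePreservingₗᵢ ℝ T hT) id n x : Lp ℝ 2 μ)
      =ᵐ[μ] birkhoffSum T x n := by
    induction n with
    | zero => simpa [birkhoffSum] using Lp.coeFn_zero ℝ 2 μ
    | succ n ih =>
      rw [birkhoffSum_succ]
      refine (Lp.coeFn_add _ _).trans ?_
      filter_upwards [ih, coeFn_iterate_compMeasurePreserving hT x n] with ω h1 h2
      simp [birkhoffSum_succ, h1, h2]
  filter_upwards [h] with ω h1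
  simp [birkhoffAverage, h1]

theorem birkhoffAverage_congr_ae (hT : MeasurePreserving T μ μ) {f g : Ω → ℝ} (h : f =ᵐ[μ] g)
    (n : ℕ) : birkhoffAverage ℝ T f n =ᵐ[μ] birkhoffAverage ℝ T g n := by
  have : ∀ᵐ ω ∂μ, ∀ k : ℕ, f (T^[k] ω) = g (T^[k] ω) :=
    ae_all_iff.2 fun k => (hT.iterate k).quasiMeasurePreserving.ae_eq h
  filter_upwards [this] with ω hω
  simp [birkhoffAverage, birkhoffSum, hω]

theorem aestronglyMeasurable_birkhoffAverage (hT : MeasurePreserving T μ μ) {f : Ω → ℝ}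
    (hf : AEStronglyMeasurable f μ) (n : ℕ) :
    AEStronglyMeasurable (birkhoffAverage ℝ T f n) μ := by
  have : birkhoffAverage ℝ T f n = fun ω => (n : ℝ)⁻¹ • ∑ k ∈ Finset.range n, f (T^[k] ω) := rfl
  rw [this]
  refine AEStronglyMeasurable.const_smul (Finset.aestronglyMeasurable_fun_sum (Finset.range n)
    (f := fun k ω => f (T^[k] ω)) fun k _ => ?_) ((n : ℝ)⁻¹)
  exact hf.comp_measurePreserving (hT.iterate k)

theorem eLpNorm_birkhoffAverage_le (hT : MeasurePreserving T μ μ) {f : Ω → ℝ}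
    (hf : AEStronglyMeasurable f μ) (n : ℕ) :
    eLpNorm (birkhoffAverage ℝ T f n) 1 μ ≤ eLpNorm f 1 μ := by
  have h : birkhoffAverage ℝ T f n = (n : ℝ)⁻¹ • ∑ k ∈ Finset.range n, f ∘ T^[k] := by
    ext ω; simp [birkhoffAverage, birkhoffSum]
  rw [h, eLpNorm_const_smul]
  have h2 : eLpNorm (∑ k ∈ Finset.range n, f ∘ T^[k]) 1 μ ≤ n * eLpNorm f 1 μ := by
    refine (eLpNorm_sum_le (fun k _ => hf.comp_measurePreserving (hT.iterate k)) le_rfl).trans ?_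
    simp [eLpNorm_comp_measurePreserving hf (hT.iterate _)]
  rcases Nat.eq_zero_or_pos n with rfl | hn
  · simp
  calc _ ≤ ‖(n : ℝ)⁻¹‖ₑ * (n * eLpNorm f 1 μ) := by gcongr
    _ = eLpNorm f 1 μ := by
      rw [← mul_assoc, Real.enorm_eq_ofReal (by positivity),
        ENNReal.ofReal_inv_of_pos (by positivity), ENNReal.ofReal_natCast,
        ENNReal.inv_mul_cancel (by simp; omega) (by simp), one_mul]

theorem integral_birkhoffAverage (hT : MeasurePreserving T μ μ) {f : Ω → ℝ}
    (hf : Integrable f μ) {n : ℕ} (hn : n ≠ 0) :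
    ∫ ω, birkhoffAverage ℝ T f n ω ∂μ = ∫ ω, f ω ∂μ := by
  have hk : ∀ k, Integrable (fun ω => f (T^[k] ω)) μ := fun k =>
    (hT.iterate k).integrable_comp_of_integrable hf
  have hi : ∀ k, ∫ ω, f (T^[k] ω) ∂μ = ∫ ω, f ω ∂μ := fun k => by
    rw [← integral_map (hT.iterate k).aemeasurable
      (by rw [(hT.iterate k).map_eq]; exact hf.1), (hT.iterate k).map_eq]
  simp only [birkhoffAverage, birkhoffSum, smul_eq_mul]
  rw [integral_const_mul, integral_finsetSum _ fun k _ => hk k]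
  simp [hi, hn]

variable [IsProbabilityMeasure μ]

theorem tendsto_eLpNorm_birkhoffAverage_of_memLp_two (hT : Ergodic T μ) {f : Ω → ℝ}
    (hf : MemLp f 2 μ) :
    Tendsto (fun n => eLpNorm (fun ω => birkhoffAverage ℝ T f n ω - ∫ ω', f ω' ∂μ) 1 μ)
      atTop (𝓝 0) := by
  have hmp := hT.toMeasurePreserving
  set U : Lp ℝ 2 μ →ₗᵢ[ℝ] Lp ℝ 2 μ := Lp.compMeasurePreservingₗᵢ ℝ T hmp
  set x : Lp ℝ 2 μ := hf.toLp f
  have key := U.toContinuousLinearMap.tendsto_birkhoffAverage_orthogonalProjection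
    U.norm_toContinuousLinearMap_le x
  set P := ((U.toContinuousLinearMap).eqLocus
    (1 : Lp ℝ 2 μ →L[ℝ] Lp ℝ 2 μ)).orthogonalProjectionOnto x with hP
  have hfix : U (P : Lp ℝ 2 μ) = P := P.2
  obtain ⟨c, hc⟩ : ∃ c : ℝ, (P : Lp ℝ 2 μ) =ᵐ[μ] Function.const Ω c := by
    refine hT.ae_eq_const_of_ae_eq_comp_ae (Lp.aestronglyMeasurable _) ?_
    have := Lp.coeFn_compMeasurePreserving (P : Lp ℝ 2 μ) hmp
    have h2 : (Lp.compMeasurePreserving T hmp (P : Lp ℝ 2 μ)) = P := hfix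
    rw [h2] at this
    exact this.symm
  have hxf : x =ᵐ[μ] f := hf.coeFn_toLp
  have hbf : ∀ n, (birkhoffAverage ℝ U id n x : Lp ℝ 2 μ) =ᵐ[μ] birkhoffAverage ℝ T f n :=
    fun n => (coeFn_birkhoffAverage_compMeasurePreserving hmp x n).trans
      (birkhoffAverage_congr_ae hmp hxf n)
  have h1 : Tendsto (fun n => eLpNorm (fun ω => birkhoffAverage ℝ T f n ω - c) 1 μ)
      atTop (𝓝 0) := by
    have h2 := (Lp.tendsto_Lp_iff_tendsto_eLpNorm' _ _).1 key
    refine tendsto_of_tendsto_of_tendsto_of_le_of_le tendsto_const_nhds h2 (fun _ => zero_le)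
      fun n => ?_
    have : eLpNorm (fun ω => birkhoffAverage ℝ T f n ω - c) 1 μ =
        eLpNorm (⇑(birkhoffAverage ℝ U id n x : Lp ℝ 2 μ) - ⇑(P : Lp ℝ 2 μ)) 1 μ := by
      refine eLpNorm_congr_ae ?_
      filter_upwards [hbf n, hc] with ω h3 h4
      simp [h3, h4]
    rw [this]
    exact eLpNorm_le_eLpNorm_of_exponent_le (by norm_num)
      ((Lp.aestronglyMeasurable _).sub (Lp.aestronglyMeasurable _))
  have hfi : Integrable f μ := hf.integrable (by norm_num)
  -- The limit is a constant, and it is the mean because averaging preserves integrals.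
  have hc' : c = ∫ ω, f ω ∂μ := by
    have h3 : Tendsto (fun n => ∫ ω, birkhoffAverage ℝ T f n ω ∂μ) atTop (𝓝 (∫ _, c ∂μ)) := by
      refine tendsto_integral_of_L1' _ (integrable_const c).aestronglyMeasurable ?_ h1
      filter_upwards [eventually_ge_atTop 0] with n _
      refine memLp_one_iff_integrable.1 ⟨aestronglyMeasurable_birkhoffAverage hmp hf.1 n, ?_⟩
      exact (eLpNorm_birkhoffAverage_le hmp hf.1 n).trans_lt
        (memLp_one_iff_integrable.2 hfi).eLpNorm_lt_top
    have h4 : Tendsto (fun n => ∫ ω, birkhoffAverage ℝ T f n ω ∂μ) atTop (𝓝 (∫ ω, f ω ∂μ)) := by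
      refine tendsto_const_nhds.congr' ?_
      filter_upwards [eventually_ne_atTop 0] with n hn
      rw [integral_birkhoffAverage hmp hfi hn]
    simpa using tendsto_nhds_unique h3 h4
  rw [← hc']
  exact h1

/-- The mean ergodic theorem in `L¹`: it holds on the dense subspace `L²`, and averaging is a
contraction of `L¹`. -/
theorem tendsto_eLpNorm_birkhoffAverage (hT : Ergodic T μ) {f : Ω → ℝ} (hf : Integrable f μ) :
    Tendsto (fun n => eLpNorm (fun ω => birkhoffAverage ℝ T f n ω - ∫ ω', f ω' ∂μ) 1 μ)
      atTop (𝓝 0) := by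
  have hmp := hT.toMeasurePreserving
  rw [ENNReal.tendsto_nhds_zero]
  intro ε hε
  have hε3 : ε / 3 ≠ 0 := by simp [hε.ne']
  obtain ⟨g, hg, hgL⟩ := (memLp_one_iff_integrable.2 hf).exists_simpleFunc_eLpNorm_sub_lt
    (by norm_num) hε3
  have hg2 : MemLp g 2 μ := g.memLp_of_isFiniteMeasure 2 μ
  have hgi : Integrable g μ := memLp_one_iff_integrable.1 hgL
  have hfg : AEStronglyMeasurable (f - ⇑g) μ := hf.1.sub hg2.1
  filter_upwards [(ENNReal.tendsto_nhds_zero.1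
    (tendsto_eLpNorm_birkhoffAverage_of_memLp_two hT hg2)) (ε / 3) (pos_iff_ne_zero.2 hε3)]
    with n hn
  have hsplit : (fun ω => birkhoffAverage ℝ T f n ω - ∫ ω', f ω' ∂μ) =
      (birkhoffAverage ℝ T (f - ⇑g) n + fun ω => birkhoffAverage ℝ T g n ω - ∫ ω', g ω' ∂μ)
        + fun _ => -∫ ω', (f - ⇑g) ω' ∂μ := by
    ext ω
    simp only [Pi.add_apply, Pi.sub_apply, birkhoffAverage, birkhoffSum, smul_eq_mul,
      Finset.sum_sub_distrib]
    rw [integral_sub hf hgi]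
    ring
  rw [hsplit]
  have m1 := aestronglyMeasurable_birkhoffAverage hmp hfg n
  have m2 : AEStronglyMeasurable (fun ω => birkhoffAverage ℝ T g n ω - ∫ ω', g ω' ∂μ) μ :=
    (aestronglyMeasurable_birkhoffAverage hmp hg2.1 n).sub aestronglyMeasurable_const
  calc _ ≤ eLpNorm (birkhoffAverage ℝ T (f - ⇑g) n) 1 μ
        + eLpNorm (fun ω => birkhoffAverage ℝ T g n ω - ∫ ω', g ω' ∂μ) 1 μ
        + eLpNorm (fun _ : Ω => -∫ ω', (f - ⇑g) ω' ∂μ) 1 μ :=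
        (eLpNorm_add_le (m1.add m2) aestronglyMeasurable_const le_rfl).trans
          (add_le_add_left (eLpNorm_add_le m1 m2 le_rfl) _)
    _ ≤ ε / 3 + ε / 3 + ε / 3 := by
        gcongr
        · exact (eLpNorm_birkhoffAverage_le hmp hfg n).trans hg.le
        · rw [eLpNorm_const _ one_ne_zero (NeZero.ne μ)]
          simp only [measure_univ, ENNReal.one_rpow, mul_one, enorm_neg]
          refine (enorm_integral_le_lintegral_enorm _).trans ?_
          rw [← eLpNorm_one_eq_lintegral_enorm]
          exact hg.le
    _ = ε := ENNReal.add_thirds ε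

/-- The weak law of large numbers along an ergodic transformation. -/
theorem tendsto_measure_birkhoffAverage_sub_gt (hT : Ergodic T μ) {f : Ω → ℝ}
    (hf : Integrable f μ) {ε : ℝ} (hε : 0 < ε) :
    Tendsto (fun n => μ {ω | ε < |birkhoffAverage ℝ T f n ω - ∫ ω', f ω' ∂μ|}) atTop (𝓝 0) := by
  have hmp := hT.toMeasurePreserving
  have h := tendstoInMeasure_of_tendsto_eLpNorm (p := 1) (μ := μ) (l := atTop) one_ne_zero
    (f := fun n => birkhoffAverage ℝ T f n) (g := fun _ => ∫ ω', f ω' ∂μ)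
    (fun n => aestronglyMeasurable_birkhoffAverage hmp hf.1 n) aestronglyMeasurable_const
    (tendsto_eLpNorm_birkhoffAverage hT hf)
  rw [tendstoInMeasure_iff_norm] at h
  refine tendsto_of_tendsto_of_tendsto_of_le_of_le tendsto_const_nhds (h ε hε)
    (fun _ => zero_le) fun n => measure_mono fun ω hω => ?_
  exact le_of_lt (Set.mem_ofPred_eq ▸ hω)

end Ergodic

/-! ### Likelihood ratios and large deviations of Gaussian words -/

section Gaussian

variable {ι : Type*} [Fintype ι]

theorem pi_withDensity {Ω : ι → Type*} [∀ i, MeasurableSpace (Ω i)] (ν : ∀ i, Measure (Ω i))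
    [∀ i, IsProbabilityMeasure (ν i)] {f : ∀ i, Ω i → ℝ≥0∞} (hf : ∀ i, Measurable (f i))
    [∀ i, SigmaFinite ((ν i).withDensity (f i))] :
    Measure.pi (fun i => (ν i).withDensity (f i)) =
      (Measure.pi ν).withDensity fun x => ∏ i, f i (x i) := by
  refine Measure.pi_eq fun s hs => ?_
  rw [withDensity_apply _ (MeasurableSet.univ_pi hs),
    ← lintegral_indicator (MeasurableSet.univ_pi hs)]
  have hm : ∀ i, Measurable ((s i).indicator (f i)) := fun i => (hf i).indicator (hs i)
  have h : ∀ x : ∀ i, Ω i, (Set.univ.pi s).indicator (fun x => ∏ i, f i (x i)) x =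
      ∏ i, (s i).indicator (f i) (x i) := by
    intro x
    by_cases hx : x ∈ Set.univ.pi s
    · rw [Set.indicator_of_mem hx]
      exact Finset.prod_congr rfl fun i _ =>
        (Set.indicator_of_mem (hx i (Set.mem_univ i)) _).symm
    · rw [Set.indicator_of_notMem hx]
      obtain ⟨i, hi⟩ : ∃ i, x i ∉ s i := by simpa [Set.mem_pi] using hx
      exact (Finset.prod_eq_zero (Finset.mem_univ i) (Set.indicator_of_notMem hi _)).symm
  simp_rw [h]
  rw [lintegral_prod_eq_prod_lintegral_of_indepFun Finset.univ
    (fun i (x : ∀ i, Ω i) => (s i).indicator (f i) (x i))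
    (iIndepFun_pi fun i => (hm i).aemeasurable) fun i => (hm i).comp (measurable_pi_apply i)]
  refine Finset.prod_congr rfl fun i _ => ?_
  rw [withDensity_apply _ (hs i), ← lintegral_indicator (hs i),
    ← (measurePreserving_eval ν i).lintegral_comp (hm i)]

/-- The likelihood ratio between two Gaussian laws, the first one centred. -/
theorem gaussianReal_eq_withDensity_gaussianReal {E s : ℝ≥0} (hE : E ≠ 0) (hs : s ≠ 0) (m : ℝ) :
    gaussianReal 0 E = (gaussianReal m s).withDensity fun x =>
      ENNReal.ofReal (√(s / E) * Real.exp ((x - m) ^ 2 / (2 * s) - x ^ 2 / (2 * E))) := by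
  rw [gaussianReal_of_var_ne_zero 0 hE, gaussianReal_of_var_ne_zero m hs,
    ← withDensity_mul _ (measurable_gaussianPDF m s) (by fun_prop)]
  congr 1
  ext x
  have hE' : (0 : ℝ) < E := by exact_mod_cast pos_iff_ne_zero.2 hE
  have hs' : (0 : ℝ) < s := by exact_mod_cast pos_iff_ne_zero.2 hs
  have hpi := Real.pi_pos
  rw [Pi.mul_apply, gaussianPDF, gaussianPDF, ← ENNReal.ofReal_mul (gaussianPDFReal_nonneg _ _ _)]
  congr 1
  rw [gaussianPDFReal, gaussianPDFReal, Real.sqrt_div hs'.le, Real.sqrt_mul (by positivity),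
    Real.sqrt_mul (by positivity) (s : ℝ)]
  have e : Real.exp (-(x - 0) ^ 2 / (2 * (E : ℝ))) = Real.exp (-(x - m) ^ 2 / (2 * (s : ℝ))) *
      Real.exp ((x - m) ^ 2 / (2 * s) - x ^ 2 / (2 * E)) := by
    rw [← Real.exp_add]
    congr 1
    ring
  rw [e]
  have h1 : √(E : ℝ) ≠ 0 := by positivity
  have h2 : √(s : ℝ) ≠ 0 := by positivity
  have h3 : √(2 * Real.pi) ≠ 0 := by positivity
  field_simp

theorem pi_gaussianReal_eq_withDensity {E s : ℝ≥0} (hE : E ≠ 0) (hs : s ≠ 0) (m : ι → ℝ) :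
    Measure.pi (fun _ : ι => gaussianReal 0 E) =
      (Measure.pi fun i => gaussianReal (m i) s).withDensity fun x =>
        ENNReal.ofReal (√(s / E) ^ Fintype.card ι *
          Real.exp (∑ i, ((x i - m i) ^ 2 / (2 * s) - x i ^ 2 / (2 * E)))) := by
  have key := fun i => gaussianReal_eq_withDensity_gaussianReal hE hs (m i)
  have : ∀ i, SigmaFinite ((gaussianReal (m i) s).withDensity fun x =>
      ENNReal.ofReal (√(s / E) * Real.exp ((x - m i) ^ 2 / (2 * s) - x ^ 2 / (2 * E)))) :=
    fun i => by rw [← key i]; infer_instance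
  calc Measure.pi (fun _ : ι => gaussianReal 0 E)
      = Measure.pi fun i => (gaussianReal (m i) s).withDensity fun x =>
        ENNReal.ofReal (√(s / E) * Real.exp ((x - m i) ^ 2 / (2 * s) - x ^ 2 / (2 * E))) := by
        congr 1; ext1 i; exact key i
    _ = _ := by
      rw [pi_withDensity _ fun i => by fun_prop]
      congr 1
      ext x
      rw [← ENNReal.ofReal_prod_of_nonneg fun i _ => by positivity, Finset.prod_mul_distrib,
        Finset.prod_const, ← Real.exp_sum, Finset.card_univ]

theorem pi_gaussianReal_le {E s : ℝ≥0} (hE : E ≠ 0) (hs : s ≠ 0) (m : ι → ℝ) {A : Set (ι → ℝ)}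
    (hA : MeasurableSet A) {B : ℝ}
    (hB : ∀ x ∈ A, ∑ i, ((x i - m i) ^ 2 / (2 * s) - x i ^ 2 / (2 * E)) ≤ B) :
    Measure.pi (fun _ : ι => gaussianReal 0 E) A ≤
      ENNReal.ofReal (√(s / E) ^ Fintype.card ι * Real.exp B) := by
  rw [pi_gaussianReal_eq_withDensity hE hs m, withDensity_apply _ hA]
  calc _ ≤ ∫⁻ _ in A, ENNReal.ofReal (√(s / E) ^ Fintype.card ι * Real.exp B)
          ∂(Measure.pi fun i => gaussianReal (m i) s) := by
        refine setLIntegral_mono measurable_const fun x hx => ?_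
        gcongr
        exact hB x hx
    _ ≤ _ := by
        rw [setLIntegral_const]
        exact mul_le_of_le_one_right' prob_le_one

theorem le_pi_gaussianReal {E s : ℝ≥0} (hE : E ≠ 0) (hs : s ≠ 0) (m : ι → ℝ) {A : Set (ι → ℝ)}
    (hA : MeasurableSet A) {B : ℝ}
    (hB : ∀ x ∈ A, B ≤ ∑ i, ((x i - m i) ^ 2 / (2 * s) - x i ^ 2 / (2 * E))) :
    ENNReal.ofReal (√(s / E) ^ Fintype.card ι * Real.exp B) *
      (Measure.pi fun i => gaussianReal (m i) s) A ≤
      Measure.pi (fun _ : ι => gaussianReal 0 E) A := by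
  rw [pi_gaussianReal_eq_withDensity hE hs m, withDensity_apply _ hA, ← setLIntegral_const]
  refine setLIntegral_mono (by fun_prop) fun x hx => ?_
  gcongr
  exact hB x hx

/-- The probability that an independent Gaussian word `x` comes close to `v`. The tilted law, under
which `x` has mean proportional to `v`, is the one whose likelihood ratio depends on `x` through
`∑ (v - a x)²` only. -/
theorem pi_gaussianReal_dist_le {E : ℝ≥0} (hE : E ≠ 0) {a t u : ℝ} (ht : 0 ≤ t)
    (hu : u = 2 * t * a ^ 2 * E) (v : ι → ℝ) (d : ℝ) :
    Measure.pi (fun _ : ι => gaussianReal 0 E) {x | ∑ i, (v i - a * x i) ^ 2 ≤ d} ≤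
      ENNReal.ofReal (√(1 / (1 + u)) ^ Fintype.card ι *
        Real.exp (t * d - t * (∑ i, v i ^ 2) / (1 + u))) := by
  have hu0 : 0 ≤ u := by rw [hu]; positivity
  have hE' : (0 : ℝ) < E := by exact_mod_cast pos_iff_ne_zero.2 hE
  obtain ⟨s, hs⟩ : ∃ s : ℝ≥0, (s : ℝ) = E / (1 + u) := ⟨⟨E / (1 + u), by positivity⟩, rfl⟩
  have hs' : (0 : ℝ) < s := by rw [hs]; positivity
  have hs0 : s ≠ 0 := by exact_mod_cast hs'.ne'
  have hA : MeasurableSet {x : ι → ℝ | ∑ i, (v i - a * x i) ^ 2 ≤ d} :=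
    measurableSet_le (by fun_prop) measurable_const
  have hr : (s : ℝ) / E = 1 / (1 + u) := by rw [hs]; field_simp
  rw [← hr]
  refine pi_gaussianReal_le hE hs0 (fun i => 2 * t * a * s * v i) hA fun x hx => ?_
  have h : ∀ i, (x i - 2 * t * a * s * v i) ^ 2 / (2 * s) - x i ^ 2 / (2 * E) =
      t * (v i - a * x i) ^ 2 - t / (1 + u) * v i ^ 2 := by
    intro i
    have h1 : (E : ℝ) = s * (1 + u) := by rw [hs]; field_simp
    have h2 : u = 2 * t * a ^ 2 * s * (1 + u) := by rw [mul_assoc _ (s : ℝ), ← h1, hu]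
    have h3 : (1 + u) ≠ 0 := by positivity
    rw [h1]
    field_simp
    linear_combination ((x i) ^ 2 - 2 * t * s * v i ^ 2) * h2
  simp_rw [h, Finset.sum_sub_distrib, ← Finset.mul_sum]
  have : t * ∑ i, (v i - a * x i) ^ 2 ≤ t * d := mul_le_mul_of_nonneg_left hx ht
  rw [div_mul_eq_mul_div]
  linarith

theorem gaussianReal_map_sub_self (m : ℝ) (s : ℝ≥0) :
    (gaussianReal m s).map (fun x => x - m) = gaussianReal 0 s := by
  rw [gaussianReal_map_sub_const]; simp

theorem memLp_sub_sq_gaussianReal (m : ℝ) (s : ℝ≥0) :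
    MemLp (fun x => (x - m) ^ 2) 2 (gaussianReal m s) := by
  have h4 : MemLp (fun x : ℝ => x - m) 4 (gaussianReal m s) :=
    (memLp_id_gaussianReal' 4 (by norm_num)).sub (memLp_const m)
  have := h4.norm_rpow_div (q := 2)
  have h2 : (4 : ℝ≥0∞) / 2 = 2 := by
    rw [ENNReal.div_eq_inv_mul]
    rw [show (4 : ℝ≥0∞) = 2 * 2 by norm_num, ← mul_assoc,
      ENNReal.inv_mul_cancel (by norm_num) (by norm_num), one_mul]
  rw [h2] at this
  refine this.congr_norm (by fun_prop) (Eventually.of_forall fun x => ?_)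
  simp

theorem memLp_mul_sub_gaussianReal (m c : ℝ) (s : ℝ≥0) :
    MemLp (fun x => c * (x - m)) 2 (gaussianReal m s) :=
  ((memLp_id_gaussianReal' 2 (by norm_num)).sub (memLp_const m)).const_mul c

theorem integral_sub_sq_gaussianReal (m : ℝ) (s : ℝ≥0) :
    ∫ x, (x - m) ^ 2 ∂gaussianReal m s = s := by
  have h := variance_eq_integral (μ := gaussianReal m s) (X := id) measurable_id.aemeasurable
  rw [variance_id_gaussianReal] at h
  simpa using h.symm

theorem variance_sub_sq_gaussianReal (m : ℝ) (s : ℝ≥0) :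
    Var[fun x => (x - m) ^ 2; gaussianReal m s] = Var[fun x => x ^ 2; gaussianReal 0 s] := by
  rw [← gaussianReal_map_sub_self m s, variance_map (by fun_prop) (by fun_prop)]
  rfl

theorem variance_mul_sub_gaussianReal (m c : ℝ) (s : ℝ≥0) :
    Var[fun x => c * (x - m); gaussianReal m s] = c ^ 2 * s := by
  rw [variance_const_mul, variance_sub_const (by fun_prop), variance_fun_id_gaussianReal]

/-- Chebyshev bound for the energy of a Gaussian word and its correlation with `v`. -/
theorem pi_gaussianReal_typical_compl_le (m v : ι → ℝ) (s : ℝ≥0) {c : ℝ} (hc : 0 < c) :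
    (Measure.pi fun i => gaussianReal (m i) s)
      {x | |∑ i, (x i - m i) ^ 2 - Fintype.card ι * s| ≤ c ∧ |∑ i, v i * (x i - m i)| ≤ c}ᶜ ≤
    ENNReal.ofReal ((Fintype.card ι * Var[fun x => x ^ 2; gaussianReal 0 s]
      + s * ∑ i, v i ^ 2) / c ^ 2) := by
  set Q := Measure.pi fun i => gaussianReal (m i) s
  have hX := fun i => memLp_sub_sq_gaussianReal (m i) s
  have hY := fun i => memLp_mul_sub_gaussianReal (m i) (v i) s
  set X : (ι → ℝ) → ℝ := ∑ i, fun ω => (ω i - m i) ^ 2 with hXdef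
  set Y : (ι → ℝ) → ℝ := ∑ i, fun ω => v i * (ω i - m i) with hYdef
  have hXi : ∀ i, MemLp (fun ω : ι → ℝ => (ω i - m i) ^ 2) 2 Q := fun i =>
    (hX i).comp_measurePreserving (measurePreserving_eval _ i)
  have hYi : ∀ i, MemLp (fun ω : ι → ℝ => v i * (ω i - m i)) 2 Q := fun i =>
    (hY i).comp_measurePreserving (measurePreserving_eval _ i)
  have hXL : MemLp X 2 Q := memLp_finsetSum' _ fun i _ => hXi i
  have hYL : MemLp Y 2 Q := memLp_finsetSum' _ fun i _ => hYi i
  have eX : ∫ ω, X ω ∂Q = Fintype.card ι * s := by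
    simp only [hXdef, Finset.sum_apply]
    rw [integral_finsetSum _ fun i _ => (hXi i).integrable (by norm_num)]
    have : ∀ i, ∫ ω : ι → ℝ, (ω i - m i) ^ 2 ∂Q = s := fun i => by
      rw [← integral_sub_sq_gaussianReal (m i) s]
      exact integral_comp_eval (μ := fun i => gaussianReal (m i) s) (i := i)
        (f := fun x => (x - m i) ^ 2) (by fun_prop)
    simp [this]
  have eY : ∫ ω, Y ω ∂Q = 0 := by
    simp only [hYdef, Finset.sum_apply]
    rw [integral_finsetSum _ fun i _ => (hYi i).integrable (by norm_num)]
    refine Finset.sum_eq_zero fun i _ => ?_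
    have h := integral_comp_eval (μ := fun i => gaussianReal (m i) s) (i := i)
        (f := fun x => v i * (x - m i)) (by fun_prop)
    refine h.trans ?_
    rw [integral_const_mul, integral_sub (f := fun x => x)
      (memLp_id_gaussianReal' 1 (by norm_num) |>.integrable le_rfl)
      (integrable_const _), integral_id_gaussianReal]
    simp
  have cX := meas_ge_le_variance_div_sq hXL hc
  have cY := meas_ge_le_variance_div_sq hYL hc
  rw [eX, variance_sum_pi hX] at cX
  rw [eY, variance_sum_pi hY] at cY
  simp only [variance_sub_sq_gaussianReal, variance_mul_sub_gaussianReal, Finset.sum_const,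
    Finset.card_univ, nsmul_eq_mul, sub_zero, ← Finset.sum_mul] at cX cY
  have hvar := variance_nonneg (fun x : ℝ => x ^ 2) (gaussianReal 0 s)
  rw [add_div, ENNReal.ofReal_add (by positivity) (by positivity)]
  refine (measure_mono ?_).trans ((measure_union_le _ _).trans (add_le_add cX
    (cY.trans_eq (by rw [mul_comm (s : ℝ)]))))
  intro x hx
  simp only [Set.mem_compl_iff, Set.mem_ofPred_eq, not_and_or, not_le] at hx
  simp only [hXdef, hYdef, Set.mem_union, Set.mem_ofPred_eq, Finset.sum_apply]
  exact hx.imp le_of_lt le_of_lt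

/-- A lower bound for the probability that an independent Gaussian word `x` beats the word `x₀`:
compare with the law `N(β v, s)`, under which the energy `p` of the noise and its correlation `q`
with `v` concentrate. -/
theorem le_pi_gaussianReal_dist_le {E s : ℝ≥0} (hE : E ≠ 0) (hs : s ≠ 0) (v x₀ : ι → ℝ)
    {a β B c : ℝ} (hc : 0 < c)
    (hdist : ∀ p q : ℝ, |p - Fintype.card ι * s| ≤ c → |q| ≤ c →
      a ^ 2 * (β ^ 2 * ∑ i, v i ^ 2 + 2 * β * q + p) - 2 * a * (β * ∑ i, v i ^ 2 + q) ≤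
        a ^ 2 * ∑ i, x₀ i ^ 2 - 2 * a * ∑ i, v i * x₀ i)
    (hratio : ∀ p q : ℝ, |p - Fintype.card ι * s| ≤ c → |q| ≤ c →
      B ≤ p / (2 * s) - (β ^ 2 * ∑ i, v i ^ 2 + 2 * β * q + p) / (2 * E)) :
    ENNReal.ofReal (√(s / E) ^ Fintype.card ι * Real.exp B) *
      (1 - ENNReal.ofReal ((Fintype.card ι * Var[fun x => x ^ 2; gaussianReal 0 s]
        + s * ∑ i, v i ^ 2) / c ^ 2)) ≤
    Measure.pi (fun _ : ι => gaussianReal 0 E)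
      {x | ∑ i, (v i - a * x i) ^ 2 ≤ ∑ i, (v i - a * x₀ i) ^ 2} := by
  set A : Set (ι → ℝ) := {x | |∑ i, (x i - β * v i) ^ 2 - Fintype.card ι * s| ≤ c ∧
    |∑ i, v i * (x i - β * v i)| ≤ c}
  have hA : MeasurableSet A := by
    change MeasurableSet ({x : ι → ℝ | |∑ i, (x i - β * v i) ^ 2 - Fintype.card ι * s| ≤ c} ∩
      {x : ι → ℝ | |∑ i, v i * (x i - β * v i)| ≤ c})
    exact (measurableSet_le (by fun_prop) measurable_const).inter
      (measurableSet_le (by fun_prop) measurable_const)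
  have hsq : ∀ x : ι → ℝ, ∑ i, x i ^ 2 = β ^ 2 * ∑ i, v i ^ 2 +
      2 * β * ∑ i, v i * (x i - β * v i) + ∑ i, (x i - β * v i) ^ 2 := by
    intro x
    simp only [Finset.mul_sum, ← Finset.sum_add_distrib]
    exact Finset.sum_congr rfl fun i _ => by ring
  have hip : ∀ x : ι → ℝ, ∑ i, v i * x i = β * ∑ i, v i ^ 2 + ∑ i, v i * (x i - β * v i) := by
    intro x
    simp only [Finset.mul_sum, ← Finset.sum_add_distrib]
    exact Finset.sum_congr rfl fun i _ => by ring
  have hexp : ∀ x : ι → ℝ, ∑ i, (v i - a * x i) ^ 2 =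
      ∑ i, v i ^ 2 - 2 * a * ∑ i, v i * x i + a ^ 2 * ∑ i, x i ^ 2 := by
    intro x
    simp only [Finset.mul_sum, ← Finset.sum_add_distrib, ← Finset.sum_sub_distrib]
    exact Finset.sum_congr rfl fun i _ => by ring
  calc _ ≤ ENNReal.ofReal (√(s / E) ^ Fintype.card ι * Real.exp B) *
        (Measure.pi fun i => gaussianReal (β * v i) s) A := by
        gcongr
        have h := pi_gaussianReal_typical_compl_le (fun i => β * v i) v s hc
        rw [prob_compl_eq_one_sub hA] at h
        rw [tsub_le_iff_right, add_comm]
        exact tsub_le_iff_right.1 h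
    _ ≤ Measure.pi (fun _ : ι => gaussianReal 0 E) A := by
        refine le_pi_gaussianReal hE hs _ hA fun x hx => ?_
        refine (hratio _ _ hx.1 hx.2).trans_eq ?_
        rw [← hsq, Finset.sum_sub_distrib, ← Finset.sum_div, ← Finset.sum_div]
    _ ≤ _ := by
        refine measure_mono fun x hx => ?_
        have := hdist _ _ hx.1 hx.2
        rw [← hsq, ← hip] at this
        simp only [Set.mem_ofPred_eq, hexp]
        linarith

end Gaussian

/-! ### The ensemble-average error probability -/

section ErrorProbability

variable {Es : ℝ≥0} {W : Kernel RSeq RSeq} {L : ℕ} {g : (Fin L → ℝ) → (Fin L → ℝ)}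

instance instIsProbabilityMeasureInputLaw (Es : ℝ≥0) : IsProbabilityMeasure (inputLaw Es) := by
  unfold inputLaw; infer_instance

instance instIsProbabilityMeasureJointLaw (Es : ℝ≥0) (W : Kernel RSeq RSeq) [IsMarkovKernel W] :
    IsProbabilityMeasure (jointLaw Es W) := by
  unfold jointLaw; infer_instance

theorem measurable_superSymbol (L k : ℕ) : Measurable (superSymbol L k) := by
  unfold superSymbol; fun_prop

theorem measurable_distMetric {α : Type*} [MeasurableSpace α] (hg : Measurable g) (a : ℝ)
    (n : ℕ) {f h : α → RSeq} (hf : Measurable f) (hh : Measurable h) :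
    Measurable fun z => distMetric L g a n (f z) (h z) := by
  have h1 : ∀ k, Measurable fun z => superSymbol L k (f z) := fun k => 
    (measurable_superSymbol L k).comp hf
  have h2 : ∀ k, Measurable fun z => g (superSymbol L k (h z)) := fun k => 
    hg.comp ((measurable_superSymbol L k).comp hh)
  unfold distMetric
  refine Measurable.const_mul (Finset.measurable_fun_sum _ fun k _ =>
    Finset.measurable_fun_sum _ fun l _ => Measurable.pow_const (Measurable.sub ?_ ?_) 2) _
  · exact (measurable_pi_apply l).comp (h2 k)
  · exact ((measurable_pi_apply l).comp (h1 k)).const_mul a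

/-- The probability that one independently drawn codeword is at least as close to the output
`ω.2` as the transmitted codeword `ω.1`. -/
noncomputable def pairwiseError (Es : ℝ≥0) (L : ℕ) (g : (Fin L → ℝ) → (Fin L → ℝ)) (a : ℝ) (n : ℕ)
    (ω : RSeq × RSeq) : ℝ≥0∞ :=
  inputLaw Es {x | distMetric L g a n x ω.2 ≤ distMetric L g a n ω.1 ω.2}

theorem measurableSet_dist_le (hg : Measurable g) (a : ℝ) (n : ℕ) :
    MeasurableSet {z : (RSeq × RSeq) × RSeq |
      distMetric L g a n z.2 z.1.2 ≤ distMetric L g a n z.1.1 z.1.2} :=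
  measurableSet_le
    (measurable_distMetric hg a n measurable_snd measurable_fst.snd)
    (measurable_distMetric hg a n measurable_fst.fst measurable_fst.snd)

theorem measurableSet_exists_dist_le {α : Type*} [MeasurableSpace α] (hg : Measurable g) (a : ℝ)
    (n k : ℕ) {f : α → Fin k → RSeq} {f₀ h : α → RSeq} (hf : Measurable f) (hf₀ : Measurable f₀)
    (hh : Measurable h) :
    MeasurableSet {z | ∃ j, distMetric L g a n (f z j) (h z) ≤
      distMetric L g a n (f₀ z) (h z)} := by
  rw [Set.ofPred_exists]
  exact MeasurableSet.iUnion fun j => measurableSet_le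
    (measurable_distMetric hg a n ((measurable_pi_apply j).comp hf) hh)
    (measurable_distMetric hg a n hf₀ hh)

theorem measurable_pairwiseError (hg : Measurable g) (a : ℝ) (n : ℕ) :
    Measurable (pairwiseError Es L g a n) :=
  measurable_measure_prodMk_left (measurableSet_dist_le hg a n)

theorem pi_exists_mem {α : Type*} [MeasurableSpace α] (μ : Measure α) [IsProbabilityMeasure μ]
    (k : ℕ) {B : Set α} (hB : MeasurableSet B) :
    Measure.pi (fun _ : Fin k => μ) {C | ∃ j, C j ∈ B} = 1 - (1 - μ B) ^ k := by
  have h : {C : Fin k → α | ∃ j, C j ∈ B} = (Set.univ.pi fun _ => Bᶜ)ᶜ := by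
    ext C; simp [Set.mem_pi]
  rw [h, prob_compl_eq_one_sub (MeasurableSet.univ_pi fun _ => hB.compl), Measure.pi_pi]
  simp [prob_compl_eq_one_sub hB]

theorem lintegral_error_eq [IsMarkovKernel W] (hg : Measurable g) (a : ℝ) (n k : ℕ)
    (m : Fin (k + 1)) :
    ∫⁻ C : Fin (k + 1) → RSeq, W (C m) {y | ∃ m' : Fin (k + 1), m' ≠ m ∧
        distMetric L g a n (C m') y ≤ distMetric L g a n (C m) y}
        ∂(Measure.pi (fun _ : Fin (k + 1) => inputLaw Es)) =
      ∫⁻ ω, 1 - (1 - pairwiseError Es L g a n ω) ^ k ∂(jointLaw Es W) := by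
  have hS : MeasurableSet {z : (RSeq × (Fin k → RSeq)) × RSeq | ∃ j : Fin k,
      distMetric L g a n (z.1.2 j) z.2 ≤ distMetric L g a n z.1.1 z.2} :=
    measurableSet_exists_dist_le hg a n k measurable_fst.snd measurable_fst.fst measurable_snd
  have hF : Measurable fun z : RSeq × (Fin k → RSeq) => W z.1 {y | ∃ j : Fin k,
      distMetric L g a n (z.2 j) y ≤ distMetric L g a n z.1 y} :=
    Kernel.measurable_kernel_prodMk_left (κ := W.comap Prod.fst measurable_fst) hS
  have hmp := measurePreserving_piFinSuccAbove (fun _ : Fin (k + 1) => inputLaw Es) m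
  calc _ = ∫⁻ C : Fin (k + 1) → RSeq, (fun z : RSeq × (Fin k → RSeq) => W z.1 {y | ∃ j : Fin k,
        distMetric L g a n (z.2 j) y ≤ distMetric L g a n z.1 y})
          (MeasurableEquiv.piFinSuccAbove (fun _ => RSeq) m C)
        ∂(Measure.pi (fun _ : Fin (k + 1) => inputLaw Es)) := by
        refine lintegral_congr fun C => ?_
        change _ = W (C m) _
        congr 1
        ext y
        constructor
        · rintro ⟨m', hm', h⟩
          obtain ⟨j, rfl⟩ := Fin.exists_succAbove_eq hm'
          exact ⟨j, h⟩
        · rintro ⟨j, h⟩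
          exact ⟨m.succAbove j, Fin.succAbove_ne m j, h⟩
    _ = ∫⁻ x, ∫⁻ C, W x {y | ∃ j : Fin k, distMetric L g a n (C j) y ≤ distMetric L g a n x y}
          ∂(Measure.pi fun _ : Fin k => inputLaw Es) ∂(inputLaw Es) := by
        rw [hmp.lintegral_comp hF, lintegral_prod _ hF.aemeasurable]
    _ = ∫⁻ x, ∫⁻ y, 1 - (1 - pairwiseError Es L g a n (x, y)) ^ k ∂(W x) ∂(inputLaw Es) := by
        refine lintegral_congr fun x => ?_
        have hSx : MeasurableSet {z : (Fin k → RSeq) × RSeq | ∃ j : Fin k,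
            distMetric L g a n (z.1 j) z.2 ≤ distMetric L g a n x z.2} :=
          measurableSet_exists_dist_le hg a n k measurable_fst measurable_const measurable_snd
        have h1 := Measure.prod_apply (μ := Measure.pi fun _ : Fin k => inputLaw Es)
          (ν := W x) hSx
        have h2 := Measure.prod_apply_symm (μ := Measure.pi fun _ : Fin k => inputLaw Es)
          (ν := W x) hSx
        refine (h1.symm.trans h2).trans (lintegral_congr fun y => ?_)
        exact pi_exists_mem (inputLaw Es) k
          ((measurableSet_dist_le hg a n).preimage (measurable_prodMk_left (x := (x, y))))
    _ = _ := by
        rw [jointLaw, Measure.lintegral_compProd]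
        exact measurable_const.sub
          ((measurable_const.sub (measurable_pairwiseError hg a n)).pow_const k)

/-- Given the transmitted codeword and the output, the competing codewords err independently. -/
theorem avgError_eq [IsMarkovKernel W] (hg : Measurable g) (a : ℝ) (n k : ℕ) :
    avgError Es W L g a n (k + 1) =
      ∫⁻ ω, 1 - (1 - pairwiseError Es L g a n ω) ^ k ∂(jointLaw Es W) := by
  unfold avgError
  simp_rw [lintegral_error_eq hg a n k]
  rw [Finset.sum_const, Finset.card_univ, Fintype.card_fin, nsmul_eq_mul, ← mul_assoc,
    ENNReal.inv_mul_cancel (by simp) (by simp), one_mul]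

theorem ENNReal.one_le_one_sub_pow_add {p : ℝ≥0∞} (hp : p ≤ 1) (k : ℕ) :
    1 ≤ (1 - p) ^ k + k * p := by
  induction k with
  | zero => simp
  | succ k ih =>
    have h : (1 - p) ^ k ≤ (1 - p) ^ (k + 1) + p :=
      calc (1 - p) ^ k = (1 - p) ^ k * ((1 - p) + p) := by rw [tsub_add_cancel_of_le hp, mul_one]
        _ ≤ (1 - p) ^ (k + 1) + p := by
          rw [mul_add, pow_succ]
          gcongr
          exact mul_le_of_le_one_left' (pow_le_one' tsub_le_self k)
    calc 1 ≤ (1 - p) ^ k + k * p := ih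
      _ ≤ (1 - p) ^ (k + 1) + p + k * p := by gcongr
      _ = _ := by push_cast; ring

theorem avgError_le [IsMarkovKernel W] (hg : Measurable g) (a : ℝ) (n k : ℕ) {A : Set (RSeq × RSeq)}
    {q : ℝ≥0∞} (hq : ∀ ω ∈ A, pairwiseError Es L g a n ω ≤ q) :
    avgError Es W L g a n (k + 1) ≤ jointLaw Es W Aᶜ + k * q := by
  rw [avgError_eq hg]
  calc _ ≤ ∫⁻ ω, Aᶜ.indicator 1 ω + k * q ∂(jointLaw Es W) := by
        refine lintegral_mono fun ω => ?_
        by_cases hω : ω ∈ A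
        · simp only [Set.indicator_of_notMem (Set.notMem_compl_iff.2 hω), zero_add]
          have hp1 : pairwiseError Es L g a n ω ≤ 1 := prob_le_one
          refine (tsub_le_iff_left.2 (ENNReal.one_le_one_sub_pow_add hp1 k)).trans ?_
          gcongr
          exact hq ω hω
        · simp only [Set.indicator_of_mem (Set.mem_compl hω), Pi.one_apply]
          exact tsub_le_self.trans le_self_add
    _ ≤ _ := by
        rw [lintegral_add_right _ measurable_const, lintegral_const, measure_univ, mul_one]
        gcongr
        exact lintegral_indicator_one_le _

theorem le_avgError [IsMarkovKernel W] (hg : Measurable g) (a : ℝ) (n k : ℕ) {A : Set (RSeq × RSeq)}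
    {q : ℝ≥0∞} (hq : ∀ ω ∈ A, q ≤ pairwiseError Es L g a n ω) :
    (1 - (1 - q) ^ k) * jointLaw Es W A ≤ avgError Es W L g a n (k + 1) := by
  rw [avgError_eq hg, ← setLIntegral_const]
  refine le_trans ?_ (setLIntegral_le_lintegral A _)
  refine setLIntegral_mono ?_ fun ω hω => ?_
  · exact measurable_const.sub
      ((measurable_const.sub (measurable_pairwiseError hg a n)).pow_const k)
  · gcongr
    exact hq ω hω

end ErrorProbability

/-! ### Typical input/output pairs -/

section Typical

variable {Es : ℝ≥0} {W : Kernel RSeq RSeq} {L : ℕ} {g : (Fin L → ℝ) → (Fin L → ℝ)}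

theorem pairShift_iterate (m : ℕ) (ω : RSeq × RSeq) :
    pairShift^[m] ω = (fun k => ω.1 (k + m), fun k => ω.2 (k + m)) := by
  induction m generalizing ω with
  | zero => rfl
  | succ m ih =>
    rw [Function.iterate_succ_apply, ih]
    simp only [pairShift, add_assoc]

theorem pairShift_iterate_iterate (L k : ℕ) (ω : RSeq × RSeq) :
    (pairShift^[L])^[k] ω = (fun j => ω.1 (j + k * L), fun j => ω.2 (j + k * L)) := by
  rw [← Function.iterate_mul, pairShift_iterate, mul_comm]

theorem superSymbol_zero_shift_fst (L k : ℕ) (ω : RSeq × RSeq) :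
    superSymbol L 0 ((pairShift^[L])^[k] ω).1 = superSymbol L k ω.1 := by
  rw [pairShift_iterate_iterate]
  ext l
  simp [superSymbol, add_comm]

theorem superSymbol_zero_shift_snd (L k : ℕ) (ω : RSeq × RSeq) :
    superSymbol L 0 ((pairShift^[L])^[k] ω).2 = superSymbol L k ω.2 := by
  rw [pairShift_iterate_iterate]
  ext l
  simp [superSymbol, add_comm]

theorem inputLaw_map_eval (Es : ℝ≥0) (k : ℕ) :
    (inputLaw Es).map (fun x => x k) = gaussianReal 0 Es :=
  Measure.infinitePi_map_eval _ k

theorem jointLaw_map_fst (Es : ℝ≥0) (W : Kernel RSeq RSeq) [IsMarkovKernel W] :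
    (jointLaw Es W).map Prod.fst = inputLaw Es :=
  Measure.fst_compProd _ _

theorem measurePreserving_input (Es : ℝ≥0) (W : Kernel RSeq RSeq) [IsMarkovKernel W] (k : ℕ) :
    MeasurePreserving (fun ω : RSeq × RSeq => ω.1 k) (jointLaw Es W) (gaussianReal 0 Es) := by
  refine ⟨(measurable_pi_apply k).comp measurable_fst, ?_⟩
  rw [← inputLaw_map_eval Es k, ← jointLaw_map_fst Es W,
    Measure.map_map (measurable_pi_apply k) measurable_fst]
  rfl

theorem memLp_input [IsMarkovKernel W] (l : Fin L) :
    MemLp (fun ω : RSeq × RSeq => superSymbol L 0 ω.1 l) 2 (jointLaw Es W) :=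
  (memLp_id_gaussianReal' 2 (by norm_num)).comp_measurePreserving
    (measurePreserving_input Es W (0 * L + l))

theorem integral_input [IsMarkovKernel W] (l : Fin L) :
    ∫ ω : RSeq × RSeq, superSymbol L 0 ω.1 l ∂(jointLaw Es W) = 0 := by
  have h := measurePreserving_input Es W (0 * L + l)
  have := integral_map (μ := jointLaw Es W) h.aemeasurable (f := fun x : ℝ => x) (by fun_prop)
  rw [h.map_eq, integral_id_gaussianReal] at this
  exact this.symm

theorem integral_input_sq [IsMarkovKernel W] (l : Fin L) :
    ∫ ω : RSeq × RSeq, superSymbol L 0 ω.1 l ^ 2 ∂(jointLaw Es W) = Es := by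
  have h := measurePreserving_input Es W (0 * L + l)
  have := integral_map (μ := jointLaw Es W) h.aemeasurable (f := fun x : ℝ => x ^ 2) (by fun_prop)
  have h2 := integral_sub_sq_gaussianReal 0 Es
  simp only [sub_zero] at h2
  rw [h.map_eq, h2] at this
  exact this.symm

theorem integral_sum_input_sq [IsMarkovKernel W] (L : ℕ) :
    ∫ ω : RSeq × RSeq, ∑ l : Fin L, superSymbol L 0 ω.1 l ^ 2 ∂(jointLaw Es W) = L * Es := by
  rw [integral_finsetSum _ fun l _ => (memLp_input l).integrable_sq]
  simp [integral_input_sq]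

/-- The first `n` transmitted super-symbols, as one word. -/
def inputWord (L n : ℕ) (x : RSeq) (p : Fin n × Fin L) : ℝ := superSymbol L p.1 x p.2

/-- The first `n` output super-symbols processed by `g`, as one word. -/
def outputWord {L : ℕ} (g : (Fin L → ℝ) → (Fin L → ℝ)) (n : ℕ) (y : RSeq)
    (p : Fin n × Fin L) : ℝ :=
  g (superSymbol L p.1 y) p.2

theorem distMetric_eq (a : ℝ) (n : ℕ) (x y : RSeq) :
    distMetric L g a n x y =
      1 / n * ∑ p, (outputWord g n y p - a * inputWord L n x p) ^ 2 := by
  rw [distMetric, Finset.sum_range, Fintype.sum_prod_type]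
  rfl

theorem inputLaw_map_inputWord (Es : ℝ≥0) (L n : ℕ) :
    (inputLaw Es).map (inputWord L n) =
      Measure.pi fun _ : Fin n × Fin L => gaussianReal 0 Es := by
  have hinj : Function.Injective fun p : Fin n × Fin L => (p.1 : ℕ) * L + p.2 := by
    have : (fun p : Fin n × Fin L => (p.1 : ℕ) * L + p.2) =
        fun p => ((finProdFinEquiv p : Fin (n * L)) : ℕ) := by
      ext p; simp [finProdFinEquiv, add_comm, mul_comm]
    rw [this]
    exact Fin.val_injective.comp finProdFinEquiv.injective
  exact (Measure.map_infinitePi_infinitePi_of_inj (P := fun _ : ℕ => gaussianReal 0 Es) hinj).trans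
    (Measure.infinitePi_eq_pi _)

theorem measurable_inputWord (L n : ℕ) : Measurable (inputWord L n) :=
  measurable_pi_iff.2 fun _ => measurable_pi_apply _

theorem pairwiseError_eq (a : ℝ) {n : ℕ} (hn : n ≠ 0) (ω : RSeq × RSeq) :
    pairwiseError Es L g a n ω = Measure.pi (fun _ : Fin n × Fin L => gaussianReal 0 Es)
      {z | ∑ p, (outputWord g n ω.2 p - a * z p) ^ 2 ≤
        ∑ p, (outputWord g n ω.2 p - a * inputWord L n ω.1 p) ^ 2} := by
  have hS : MeasurableSet {z : Fin n × Fin L → ℝ |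
      ∑ p, (outputWord g n ω.2 p - a * z p) ^ 2 ≤
        ∑ p, (outputWord g n ω.2 p - a * inputWord L n ω.1 p) ^ 2} :=
    measurableSet_le (by fun_prop) measurable_const
  rw [← inputLaw_map_inputWord, Measure.map_apply (measurable_inputWord L n) hS, pairwiseError]
  congr 1
  ext x
  have hn' : (0 : ℝ) < 1 / n := by positivity
  simp only [Set.mem_ofPred_eq, Set.mem_preimage, distMetric_eq]
  exact mul_le_mul_iff_right₀ hn'

/-- The input/output pairs whose first `n` super-symbols have empirical second moments within `ε`
of their means. -/
def typicalSet (Es : ℝ≥0) (W : Kernel RSeq RSeq) (L : ℕ) (g : (Fin L → ℝ) → (Fin L → ℝ)) (n : ℕ)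
    (ε : ℝ) : Set (RSeq × RSeq) :=
  {ω | |∑ p, outputWord g n ω.2 p ^ 2 - n * outPower Es W L g| ≤ n * ε ∧
    |∑ p, inputWord L n ω.1 p * outputWord g n ω.2 p - n * crossCorr Es W L g| ≤ n * ε ∧
    |∑ p, inputWord L n ω.1 p ^ 2 - n * (L * Es)| ≤ n * ε}

theorem integrable_out (hg : IsAdmissible Es W L g) :
    Integrable (fun ω : RSeq × RSeq => ∑ l : Fin L, g (superSymbol L 0 ω.2) l ^ 2)
      (jointLaw Es W) :=
  integrable_finsetSum _ fun l _ => (hg.2 l).integrable_sq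

theorem integrable_cross [IsMarkovKernel W] (hg : IsAdmissible Es W L g) :
    Integrable (fun ω : RSeq × RSeq =>
      ∑ l : Fin L, superSymbol L 0 ω.1 l * g (superSymbol L 0 ω.2) l) (jointLaw Es W) :=
  integrable_finsetSum _ fun l _ => (memLp_input l).integrable_mul (hg.2 l)

theorem tendsto_typicalSet_compl [IsMarkovKernel W] (hT : Ergodic (pairShift^[L]) (jointLaw Es W))
    (hg : IsAdmissible Es W L g) {ε : ℝ} (hε : 0 < ε) :
    Tendsto (fun n => jointLaw Es W (typicalSet Es W L g n ε)ᶜ) atTop (𝓝 0) := by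
  have h1 := tendsto_measure_birkhoffAverage_sub_gt hT (integrable_out hg) hε
  have h2 := tendsto_measure_birkhoffAverage_sub_gt hT (integrable_cross hg) hε
  have h3 := tendsto_measure_birkhoffAverage_sub_gt hT (μ := jointLaw Es W)
    (f := fun ω : RSeq × RSeq => ∑ l : Fin L, superSymbol L 0 ω.1 l ^ 2)
    (integrable_finsetSum _ fun l _ => (memLp_input l).integrable_sq) hε
  have h := (h1.add h2).add h3
  simp only [add_zero] at h
  refine tendsto_of_tendsto_of_tendsto_of_le_of_le' tendsto_const_nhds h
    (Eventually.of_forall fun _ => zero_le) ?_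
  filter_upwards [eventually_gt_atTop 0] with n hn
  refine (measure_mono ?_).trans ((measure_union_le _ _).trans
    (add_le_add_left (measure_union_le _ _) _))
  have hn' : (0 : ℝ) < n := by exact_mod_cast hn
  have hscale : ∀ s m : ℝ, n * ε < |s - n * m| → ε < |(n : ℝ)⁻¹ * s - m| := by
    intro s m h
    have : s - n * m = n * ((n : ℝ)⁻¹ * s - m) := by field_simp
    rw [this, abs_mul, abs_of_pos hn'] at h
    exact lt_of_mul_lt_mul_left h hn'.le
  intro ω hω
  simp only [typicalSet, Set.mem_compl_iff, Set.mem_ofPred_eq, not_and_or, not_le] at hω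
  simp only [Set.mem_union, Set.mem_ofPred_eq, birkhoffAverage, birkhoffSum, smul_eq_mul,
    superSymbol_zero_shift_fst, superSymbol_zero_shift_snd, integral_sum_input_sq,
    Finset.sum_range]
  simp only [Fintype.sum_prod_type] at hω
  rcases hω with h | h | h
  · exact Or.inl (Or.inl (hscale _ _ h))
  · exact Or.inl (Or.inr (hscale _ _ h))
  · exact Or.inr (hscale _ _ h)

end Typical

/-! ### Achievable and non-achievable rates -/

section Rates

variable {Es : ℝ≥0} {W : Kernel RSeq RSeq} {L : ℕ} {g : (Fin L → ℝ) → (Fin L → ℝ)}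

theorem exists_ceil_exp_eq_succ (r : ℝ) :
    ∃ k : ℕ, ⌈Real.exp r⌉₊ = k + 1 ∧ (k : ℝ) ≤ Real.exp r ∧ Real.exp r ≤ k + 1 := by
  have hpos : 0 < ⌈Real.exp r⌉₊ := Nat.ceil_pos.2 (Real.exp_pos r)
  obtain ⟨k, hk⟩ := Nat.exists_eq_succ_of_ne_zero hpos.ne'
  refine ⟨k, hk, ?_, ?_⟩
  · have := Nat.ceil_lt_add_one (Real.exp_pos r).le
    rw [hk] at this
    push_cast at this
    linarith
  · have := Nat.le_ceil (Real.exp r)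
    rw [hk] at this
    exact_mod_cast this

/-- At rate zero there is a single message, hence no competitor. -/
theorem isAchievable_zero [IsMarkovKernel W] (hg : Measurable g) (a : ℝ) :
    IsAchievable Es W L g a 0 := by
  have h : ∀ n : ℕ, avgError Es W L g a n ⌈Real.exp ((n : ℝ) * (L : ℝ) * 0)⌉₊ = 0 := by
    intro n
    have := avgError_eq (Es := Es) (W := W) hg a n 0
    simpa using this
  unfold IsAchievable
  simp_rw [h]
  exact tendsto_const_nhds

theorem sqrt_pow_eq_exp {r : ℝ} (hr : 0 < r) (n L : ℕ) :
    √r ^ (n * L) = Real.exp (n * (L / 2 * Real.log r)) := by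
  rw [← Real.exp_log (Real.sqrt_pos.2 hr), ← Real.exp_nat_mul, Real.log_sqrt hr.le]
  congr 1
  push_cast
  ring

theorem tendsto_exp_neg_nat_mul {δ : ℝ} (hδ : 0 < δ) :
    Tendsto (fun n : ℕ => Real.exp (-(n * δ))) atTop (𝓝 0) :=
  Real.tendsto_exp_neg_atTop_nhds_zero.comp
    (tendsto_natCast_atTop_atTop.atTop_mul_const hδ)

/-- Rates below the error exponent of a single competing codeword are achievable, by the union
bound. The parameter `t` is the free parameter of the exponential bound. -/
theorem isAchievable_of_lt [IsMarkovKernel W] (hEs : Es ≠ 0)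
    (hT : Ergodic (pairShift^[L]) (jointLaw Es W)) (hg : IsAdmissible Es W L g) {a t u R : ℝ}
    (ht : 0 ≤ t) (hu : u = 2 * t * a ^ 2 * Es)
    (hR : L * R < L / 2 * Real.log (1 + u) + t * outPower Es W L g / (1 + u) -
      t * (outPower Es W L g - 2 * a * crossCorr Es W L g + a ^ 2 * (L * Es))) :
    IsAchievable Es W L g a R := by
  set G := outPower Es W L g with hG
  set C := crossCorr Es W L g with hC
  set J := L / 2 * Real.log (1 + u) + t * G / (1 + u) -
    t * (G - 2 * a * C + a ^ 2 * (L * Es)) with hJ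
  have hu0 : 0 ≤ u := by rw [hu]; positivity
  set K := t * (1 + 2 * |a| + a ^ 2) + t / (1 + u) with hK
  have hK0 : 0 ≤ K := by positivity
  set δ := (J - L * R) / 2 with hδ
  have hδ0 : 0 < δ := by rw [hδ]; linarith
  set ε := δ / (K + 1) with hε
  have hε0 : 0 < ε := by positivity
  have hεK : ε * K ≤ δ := by
    rw [hε, div_mul_eq_mul_div, div_le_iff₀ (by positivity)]
    nlinarith
  have hbound : ∀ n : ℕ, n ≠ 0 → avgError Es W L g a n ⌈Real.exp ((n : ℝ) * (L : ℝ) * R)⌉₊ ≤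
      jointLaw Es W (typicalSet Es W L g n ε)ᶜ + ENNReal.ofReal (Real.exp (-(n * δ))) := by
    intro n hn
    obtain ⟨k, hk, hk1, -⟩ := exists_ceil_exp_eq_succ ((n : ℝ) * (L : ℝ) * R)
    rw [hk]
    have hq : ∀ ω ∈ typicalSet Es W L g n ε, pairwiseError Es L g a n ω ≤
        ENNReal.ofReal (Real.exp (-(n * (J - ε * K)))) := by
      rintro ω ⟨h1, h2, h3⟩
      rw [pairwiseError_eq a hn]
      refine (pi_gaussianReal_dist_le hEs ht hu _ _).trans (ENNReal.ofReal_le_ofReal ?_)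
      rw [Fintype.card_prod, Fintype.card_fin, Fintype.card_fin, sqrt_pow_eq_exp (by positivity),
        ← Real.exp_add, Real.exp_le_exp]
      set v := outputWord g n ω.2
      set x := inputWord L n ω.1
      rw [← hG, abs_le] at h1
      rw [← hC] at h2
      rw [abs_le] at h3
      have hexp : ∑ p, (v p - a * x p) ^ 2 =
          ∑ p, v p ^ 2 - 2 * (a * ∑ p, x p * v p) + a ^ 2 * ∑ p, x p ^ 2 := by
        simp only [Finset.mul_sum, ← Finset.sum_add_distrib, ← Finset.sum_sub_distrib]
        exact Finset.sum_congr rfl fun i _ => by ring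
      have hcross : a * (n * C) - a * ∑ p, x p * v p ≤ |a| * (n * ε) := by
        rw [← mul_sub]
        refine (le_abs_self _).trans ?_
        rw [abs_mul, abs_sub_comm]
        gcongr
      have hx : a ^ 2 * ∑ p, x p ^ 2 ≤ a ^ 2 * (n * (L * Es) + n * ε) := by
        gcongr; linarith [h3.2]
      have hd : ∑ p, (v p - a * x p) ^ 2 ≤
          n * (G - 2 * a * C + a ^ 2 * (L * Es)) + n * ε * (1 + 2 * |a| + a ^ 2) := by
        rw [hexp]
        linarith [h1.2]
      have hv : t * (n * G - n * ε) / (1 + u) ≤ t * (∑ p, v p ^ 2) / (1 + u) := by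
        gcongr; linarith [h1.1]
      have htd := mul_le_mul_of_nonneg_left hd ht
      have hlog : Real.log (1 / (1 + u)) = -Real.log (1 + u) := by
        rw [one_div, Real.log_inv]
      rw [hlog]
      have hfin : n * (L / 2 * -Real.log (1 + u)) +
          (t * (n * (G - 2 * a * C + a ^ 2 * (L * Es)) + n * ε * (1 + 2 * |a| + a ^ 2)) -
            t * (n * G - n * ε) / (1 + u)) = -(n * (J - ε * K)) := by
        rw [hJ, hK]; ring
      linarith
    refine (avgError_le hg.1 a n k hq).trans ?_
    gcongr
    rw [← ENNReal.ofReal_natCast, ← ENNReal.ofReal_mul (by positivity)]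
    refine ENNReal.ofReal_le_ofReal ?_
    calc (k : ℝ) * Real.exp (-(n * (J - ε * K)))
        ≤ Real.exp (n * L * R) * Real.exp (-(n * (J - ε * K))) := by gcongr
      _ = Real.exp (n * L * R - n * (J - ε * K)) := by rw [← Real.exp_add]; rfl
      _ ≤ Real.exp (-(n * δ)) := by
        rw [Real.exp_le_exp]
        have : (n : ℝ) * (ε * K) ≤ n * δ := by gcongr
        have h2 : (n : ℝ) * (2 * δ) = n * (J - L * R) := by rw [hδ]; ring
        linarith
  have hlim : Tendsto (fun n : ℕ => jointLaw Es W (typicalSet Es W L g n ε)ᶜ +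
      ENNReal.ofReal (Real.exp (-(n * δ)))) atTop (𝓝 0) := by
    have h1 := tendsto_typicalSet_compl hT hg hε0
    have h2 := ENNReal.tendsto_ofReal (tendsto_exp_neg_nat_mul hδ0)
    simpa using h1.add h2
  refine tendsto_of_tendsto_of_tendsto_of_le_of_le' tendsto_const_nhds hlim
    (Eventually.of_forall fun _ => zero_le) ?_
  filter_upwards [eventually_ne_atTop 0] with n hn using hbound n hn

/-- Cauchy–Schwarz for vector-valued square-integrable functions. -/
theorem sq_integral_sum_mul_le {Ω : Type*} [MeasurableSpace Ω] {μ : Measure Ω}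
    {f h : Fin L → Ω → ℝ} (hf : ∀ l, MemLp (f l) 2 μ) (hh : ∀ l, MemLp (h l) 2 μ) :
    (∫ ω, ∑ l, f l ω * h l ω ∂μ) ^ 2 ≤
      (∫ ω, ∑ l, f l ω ^ 2 ∂μ) * ∫ ω, ∑ l, h l ω ^ 2 ∂μ := by
  have i1 : Integrable (fun ω => ∑ l, f l ω ^ 2) μ :=
    integrable_finsetSum _ fun l _ => (hf l).integrable_sq
  have i2 : Integrable (fun ω => ∑ l, h l ω ^ 2) μ :=
    integrable_finsetSum _ fun l _ => (hh l).integrable_sq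
  have i3 : Integrable (fun ω => ∑ l, f l ω * h l ω) μ :=
    integrable_finsetSum _ fun l _ => (hf l).integrable_mul (hh l)
  have key : ∀ t : ℝ, 0 ≤ (∫ ω, ∑ l, f l ω ^ 2 ∂μ) * (t * t) +
      (2 * ∫ ω, ∑ l, f l ω * h l ω ∂μ) * t + ∫ ω, ∑ l, h l ω ^ 2 ∂μ := by
    intro t
    have h0 : 0 ≤ ∫ ω, ∑ l, (t * f l ω + h l ω) ^ 2 ∂μ :=
      integral_nonneg fun ω => Finset.sum_nonneg fun l _ => sq_nonneg _
    have he : ∀ ω, ∑ l, (t * f l ω + h l ω) ^ 2 = (t * t) * ∑ l, f l ω ^ 2 +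
        (2 * t) * ∑ l, f l ω * h l ω + ∑ l, h l ω ^ 2 := by
      intro ω
      simp only [Finset.mul_sum, ← Finset.sum_add_distrib]
      exact Finset.sum_congr rfl fun i _ => by ring
    simp_rw [he] at h0
    rw [integral_add (f := fun ω => (t * t) * ∑ l, f l ω ^ 2 + (2 * t) * ∑ l, f l ω * h l ω)
      ((i1.const_mul _).add (i3.const_mul _)) i2,
      integral_add (i1.const_mul _) (i3.const_mul _), integral_const_mul, integral_const_mul] at h0
    linarith
  have := discrim_le_zero key
  rw [discrim] at this
  linarith

theorem outPower_nonneg : 0 ≤ outPower Es W L g :=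
  integral_nonneg fun _ => Finset.sum_nonneg fun _ _ => sq_nonneg _

theorem sq_crossCorr_le [IsMarkovKernel W] (hg : IsAdmissible Es W L g) :
    crossCorr Es W L g ^ 2 ≤ L * Es * outPower Es W L g := by
  rw [← integral_sum_input_sq (W := W) L]
  exact sq_integral_sum_mul_le memLp_input hg.2

theorem one_sub_pow_le_half {q : ℝ} (hq : q ≤ 1) {k : ℕ} (hk : 1 ≤ k * q) :
    (1 - q) ^ k ≤ 1 / 2 := by
  have h1 : (1 - q) ^ k ≤ Real.exp (-q) ^ k := by
    exact pow_le_pow_left₀ (by linarith) (by linarith [Real.add_one_le_exp (-q)]) k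
  rw [← Real.exp_nat_mul] at h1
  refine h1.trans ((Real.exp_le_exp.2 (by linarith : (k : ℝ) * -q ≤ -1)).trans ?_)
  rw [Real.exp_neg, one_div]
  exact inv_anti₀ (by norm_num) (by linarith [Real.add_one_le_exp (1 : ℝ)])

/-- On typical pairs a competing codeword wins with probability at least `exp (-n r) / 2`, for
every `r > (L / 2) log (Es / s)` and every `s < (1 - Δ) Es`. -/
theorem exists_le_pairwiseError [IsMarkovKernel W] (hEs : Es ≠ 0)
    (hg : IsAdmissible Es W L g) (a : ℝ) {s : ℝ≥0} (hs : s ≠ 0)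
    (hsE : L * (s : ℝ) + crossCorr Es W L g ^ 2 / outPower Es W L g < L * Es) {r : ℝ}
    (hr : L / 2 * Real.log (Es / s) < r) :
    ∃ ε > 0, ∀ᶠ n : ℕ in atTop, ∀ ω ∈ typicalSet Es W L g n ε,
      ENNReal.ofReal (Real.exp (-(n * r)) / 2) ≤ pairwiseError Es L g a n ω := by
  set G := outPower Es W L g with hG
  set C := crossCorr Es W L g with hC
  have hG0 : 0 ≤ G := outPower_nonneg
  have hs' : (0 : ℝ) < s := by exact_mod_cast pos_iff_ne_zero.2 hs
  have hE' : (0 : ℝ) < Es := by exact_mod_cast pos_iff_ne_zero.2 hEs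
  -- If `G = 0` then also `C = 0` and `β = 0`, so that the two identities below still hold.
  obtain ⟨β, hβ1, hβ2⟩ : ∃ β : ℝ, β * G = C ∧ β ^ 2 * G = C ^ 2 / G := by
    refine ⟨C / G, ?_, ?_⟩
    · rcases hG0.eq_or_lt with h | h
      · have : C ^ 2 ≤ 0 := by
          have := sq_crossCorr_le hg
          rwa [← hG, ← h, mul_zero] at this
        rw [← h, mul_zero, eq_comm]
        nlinarith
      · field_simp
    · rcases hG0.eq_or_lt with h | h
      · simp [← h]
      · field_simp
  set κ := L * (Es : ℝ) - L * s - C ^ 2 / G with hκ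
  have hκ0 : 0 < κ := by rw [hκ]; linarith
  set b := β ^ 2 + 2 * |β| + 2 with hb
  have hb0 : 0 < b := by positivity
  obtain ⟨ε, hε0, hε1, hε2, hε3⟩ : ∃ ε > 0, ε * b ≤ κ / 2 ∧
      (a ≠ 0 → 4 * (|β| + 2) * ε ≤ |a| * κ) ∧ ε / (2 * s) ≤ r - L / 2 * Real.log (Es / s) := by
    have t : ∀ c : ℝ, Tendsto (fun ε : ℝ => c * ε) (𝓝[>] 0) (𝓝 0) := fun c => by
      have : Tendsto (fun ε : ℝ => c * ε) (𝓝 0) (𝓝 (c * 0)) := tendsto_id.const_mul c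
      rw [mul_zero] at this
      exact this.mono_left nhdsWithin_le_nhds
    have e1 := (t b).eventually_le_const (half_pos hκ0)
    have e2 : ∀ᶠ ε : ℝ in 𝓝[>] 0, a ≠ 0 → 4 * (|β| + 2) * ε ≤ |a| * κ := by
      by_cases ha : a = 0
      · simp [ha]
      · filter_upwards [(t (4 * (|β| + 2))).eventually_le_const
          (mul_pos (abs_pos.2 ha) hκ0)] with ε h _ using h
    have e3 := (t (1 / (2 * s))).eventually_le_const (sub_pos.2 hr)
    have e0 : ∀ᶠ ε : ℝ in 𝓝[>] 0, 0 < ε := self_mem_nhdsWithin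
    obtain ⟨ε, h1, h2, h3, h4⟩ := (e0.and (e1.and (e2.and e3))).exists
    exact ⟨ε, h1, by linarith, h3, by rw [div_eq_inv_mul, ← one_div]; exact h4⟩
  refine ⟨ε, hε0, ?_⟩
  set V := Var[fun x => x ^ 2; gaussianReal 0 s] with hV
  have hV0 : 0 ≤ V := variance_nonneg _ _
  have hlim : Tendsto (fun n : ℕ => (L * V + s * (G + ε)) / ε ^ 2 / (n : ℝ)) atTop (𝓝 0) :=
    tendsto_const_nhds.div_atTop tendsto_natCast_atTop_atTop
  filter_upwards [hlim.eventually_le_const (by norm_num : (0 : ℝ) < 1 / 2), eventually_ne_atTop 0]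
    with n hn2 hn
  have hn0 : (0 : ℝ) < n := by positivity
  rintro ω ⟨h1, h2, h3⟩
  rw [pairwiseError_eq a hn]
  set v := outputWord g n ω.2
  set x := inputWord L n ω.1
  rw [← hG] at h1
  rw [← hC] at h2
  have hcomm : ∑ p, v p * x p = ∑ p, x p * v p := Finset.sum_congr rfl fun p _ => mul_comm _ _
  have hcard : (Fintype.card (Fin n × Fin L) : ℝ) = n * L := by simp
  -- The energy of the tilted word falls short of that of the transmitted one by about `n κ`.
  have henergy : ∀ p q : ℝ, |p - Fintype.card (Fin n × Fin L) * s| ≤ n * ε → |q| ≤ n * ε →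
      β ^ 2 * ∑ i, v i ^ 2 + 2 * β * q + p ≤ n * (L * Es) - n * κ + n * ε * (b - 1) := by
    intro p q hp hq
    rw [hcard] at hp
    have e1 : β ^ 2 * ∑ i, v i ^ 2 ≤ β ^ 2 * (n * G + n * ε) := by
      gcongr; linarith [(abs_le.1 h1).2]
    have e2 : 2 * β * q ≤ 2 * |β| * (n * ε) := by
      refine (le_abs_self _).trans ?_
      rw [abs_mul, abs_mul, abs_two]
      gcongr
    have e3 : n * κ = n * (L * Es) - n * (L * s) - n * (β ^ 2 * G) := by rw [hβ2, hκ]; ring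
    have e4 : n * ε * (b - 1) = β ^ 2 * (n * ε) + 2 * |β| * (n * ε) + n * ε := by rw [hb]; ring
    linarith [(abs_le.1 hp).2]
  have hεn : n * ε * b ≤ n * κ / 2 := by
    have : n * (ε * b) ≤ n * (κ / 2) := by gcongr
    linarith
  have hnε : 0 < n * ε := by positivity
  have hnκ : 0 < n * κ := by positivity
  refine le_trans ?_ (le_pi_gaussianReal_dist_le hEs hs v x (a := a) (β := β)
    (B := -(n * (ε / (2 * s)))) (c := n * ε) hnε ?_ ?_)
  · rw [← hV, hcard, Fintype.card_prod, Fintype.card_fin, Fintype.card_fin]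
    have hprob : (n * L * V + s * ∑ i, v i ^ 2) / (n * ε) ^ 2 ≤ 1 / 2 := by
      refine le_trans ?_ hn2
      have e1 : s * ∑ i, v i ^ 2 ≤ s * (n * (G + ε)) := by
        gcongr; linarith [(abs_le.1 h1).2]
      calc _ ≤ (n * L * V + s * (n * (G + ε))) / (n * ε) ^ 2 := by gcongr
        _ = _ := by field_simp
    calc ENNReal.ofReal (Real.exp (-(n * r)) / 2)
        = ENNReal.ofReal (Real.exp (-(n * r))) * ENNReal.ofReal (1 - 1 / 2) := by
          rw [← ENNReal.ofReal_mul (Real.exp_pos _).le]; congr 1; ring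
      _ ≤ _ := by
          rw [← ENNReal.ofReal_one, ← ENNReal.ofReal_sub _ (by positivity)]
          have hlog : Real.log (s / Es) = -Real.log (Es / s) := by
            rw [← Real.log_inv, inv_div]
          have hexp : Real.exp (-(n * r)) ≤
              √(s / Es : ℝ) ^ (n * L) * Real.exp (-(n * (ε / (2 * s)))) := by
            rw [sqrt_pow_eq_exp (by positivity), ← Real.exp_add, Real.exp_le_exp, hlog]
            have := mul_le_mul_of_nonneg_left hε3 hn0.le
            linarith
          gcongr
  · intro p q hp hq
    have e1 := henergy p q hp hq
    have e2 : |(β * ∑ i, v i ^ 2 + q) - ∑ i, v i * x i| ≤ (|β| + 2) * (n * ε) := by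
      have : (β * ∑ i, v i ^ 2 + q) - ∑ i, v i * x i =
          β * (∑ i, v i ^ 2 - n * G) + q - (∑ i, x i * v i - n * C) := by
        rw [hcomm, ← hβ1]; ring
      rw [this]
      refine (abs_sub _ _).trans ?_
      have := abs_add_le (β * (∑ i, v i ^ 2 - n * G)) q
      have e3 : |β * (∑ i, v i ^ 2 - n * G)| ≤ |β| * (n * ε) := by
        rw [abs_mul]; gcongr
      linarith
    by_cases ha : a = 0
    · simp [ha]
    have ha' : 0 < |a| := abs_pos.2 ha
    have e4 : a * (∑ i, v i * x i - (β * ∑ i, v i ^ 2 + q)) ≤ |a| * ((|β| + 2) * (n * ε)) := by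
      refine (le_abs_self _).trans ?_
      rw [abs_mul, abs_sub_comm]
      gcongr
    have e5 : 4 * (|a| * ((|β| + 2) * (n * ε))) ≤ a ^ 2 * (n * κ) := by
      have := mul_le_mul_of_nonneg_left (hε2 ha) (mul_pos hn0 ha').le
      calc _ = n * |a| * (4 * (|β| + 2) * ε) := by ring
        _ ≤ n * |a| * (|a| * κ) := this
        _ = |a| ^ 2 * (n * κ) := by ring
        _ = _ := by rw [sq_abs]
    have e6 : β ^ 2 * ∑ i, v i ^ 2 + 2 * β * q + p - ∑ i, x i ^ 2 ≤ -(n * κ / 2) := by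
      linarith [(abs_le.1 h3).1]
    have e7 := mul_le_mul_of_nonneg_left e6 (sq_nonneg a)
    linarith
  · intro p q hp hq
    have e1 := henergy p q hp hq
    rw [hcard] at hp
    have e2 : (β ^ 2 * ∑ i, v i ^ 2 + 2 * β * q + p) / (2 * Es) ≤ n * L / 2 := by
      rw [div_le_div_iff₀ (by positivity) (by positivity)]
      have : β ^ 2 * ∑ i, v i ^ 2 + 2 * β * q + p ≤ n * (L * Es) := by linarith
      linarith
    have e3 : n * L / 2 - n * (ε / (2 * s)) ≤ p / (2 * s) := by
      rw [le_div_iff₀ (by positivity)]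
      have : (n * L / 2 - n * (ε / (2 * s))) * (2 * s) = n * L * s - n * ε := by field_simp
      rw [this]
      linarith [(abs_le.1 hp).1]
    linarith

/-- The competing codewords are independent given the transmitted one and the output, so above the
exponent of a single competitor one of them wins with probability bounded away from zero. -/
theorem not_isAchievable_of_lt [IsMarkovKernel W] (hEs : Es ≠ 0) (hL : 1 ≤ L)
    (hT : Ergodic (pairShift^[L]) (jointLaw Es W)) (hg : IsAdmissible Es W L g) (a : ℝ) {s : ℝ≥0}
    (hs : s ≠ 0) (hsE : L * (s : ℝ) + crossCorr Es W L g ^ 2 / outPower Es W L g < L * Es) {R : ℝ}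
    (hR : 1 / 2 * Real.log (Es / s) < R) : ¬ IsAchievable Es W L g a R := by
  have hL0 : (0 : ℝ) < L := by exact_mod_cast hL
  have hR' : L / 2 * Real.log (Es / s) < L * R := by
    have := mul_lt_mul_of_pos_left hR hL0
    linarith
  obtain ⟨r, hr1, hr2⟩ := exists_between hR'
  obtain ⟨ε, hε0, hε⟩ := exists_le_pairwiseError hEs hg a hs hsE hr1
  intro hach
  have e1 := (ENNReal.tendsto_nhds_zero.1 hach) (1 / 8) (by simp)
  have e2 := (ENNReal.tendsto_nhds_zero.1 (tendsto_typicalSet_compl hT hg hε0)) (1 / 2) (by simp)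
  have hr0 : 0 ≤ r := by
    have h1 : 0 ≤ crossCorr Es W L g ^ 2 / outPower Es W L g :=
      div_nonneg (sq_nonneg _) outPower_nonneg
    have h2 : (s : ℝ) ≤ Es := le_of_mul_le_mul_left (by linarith) hL0
    have hs' : (0 : ℝ) < s := by exact_mod_cast pos_iff_ne_zero.2 hs
    have h3 : 0 ≤ Real.log (Es / s) := Real.log_nonneg ((one_le_div hs').2 h2)
    exact (by positivity : 0 ≤ L / 2 * Real.log (Es / s)).trans hr1.le
  have e3 : ∀ᶠ n : ℕ in atTop, 1 ≤ (Real.exp (n * L * R) - 1) * (Real.exp (-(n * r)) / 2) := by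
    have hδ : 0 < L * R - r := by linarith
    have h1 : Tendsto (fun n : ℕ => Real.exp (n * (L * R - r))) atTop atTop :=
      Real.tendsto_exp_atTop.comp (tendsto_natCast_atTop_atTop.atTop_mul_const hδ)
    filter_upwards [h1.eventually_ge_atTop 3] with n hn
    have h2 : Real.exp (n * L * R) * Real.exp (-(n * r)) = Real.exp (n * (L * R - r)) := by
      rw [← Real.exp_add]; congr 1; ring
    have h3 : Real.exp (-(n * r)) ≤ 1 := Real.exp_le_one_iff.2 (by
      have : 0 ≤ n * r := by positivity
      linarith)
    linarith
  obtain ⟨n, h1, h2, h3, h4⟩ := (e1.and (e2.and (e3.and hε))).exists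
  obtain ⟨k, hk, -, hk2⟩ := exists_ceil_exp_eq_succ ((n : ℝ) * (L : ℝ) * R)
  rw [hk] at h1
  set q := Real.exp (-(n * r)) / 2 with hq
  have hq0 : 0 < q := by positivity
  have hq1 : q ≤ 1 := by
    have : Real.exp (-(n * r)) ≤ 1 := Real.exp_le_one_iff.2 (by
      have : 0 ≤ n * r := by positivity
      linarith)
    linarith
  have hpow : (1 - ENNReal.ofReal q) ^ k ≤ 1 / 2 := by
    have h := one_sub_pow_le_half hq1 (k := k) (h3.trans (by gcongr; linarith))
    rw [← ENNReal.ofReal_one, ← ENNReal.ofReal_sub _ hq0.le, ← ENNReal.ofReal_pow (by linarith)]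
    refine (ENNReal.ofReal_le_ofReal h).trans ?_
    rw [ENNReal.ofReal_div_of_pos (by norm_num)]; simp
  have hA : 1 / 2 ≤ jointLaw Es W (typicalSet Es W L g n ε) := by
    have h5 : 1 ≤ jointLaw Es W (typicalSet Es W L g n ε) +
        jointLaw Es W (typicalSet Es W L g n ε)ᶜ := by
      rw [← measure_univ (μ := jointLaw Es W), ← Set.union_compl_self (typicalSet Es W L g n ε)]
      exact measure_union_le _ _
    have h6 := h5.trans (add_le_add_right h2 _)
    rw [← tsub_le_iff_right] at h6
    simpa using h6
  have h7 := le_avgError (W := W) hg.1 a n k h4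
  have h8 : (1 / 2 : ℝ≥0∞) * (1 / 2) ≤ 1 / 8 := by
    refine le_trans ?_ (h7.trans h1)
    gcongr
    have : (1 : ℝ≥0∞) / 2 = 1 - 1 / 2 := by simp
    rw [this]
    gcongr
  have h9 := ENNReal.toReal_mono (by simp) h8
  norm_num at h9

end Rates

/-! ### The function `½ log (1 + p / q)` -/

section HalfLog

theorem halfLogSNR_eq_log_rpow (p q : ℝ) :
    halfLogSNR p q =
      ENNReal.log ((1 + ENNReal.ofReal p / ENNReal.ofReal q) ^ (1 / 2 : ℝ)) := by
  rw [ENNReal.log_rpow, halfLogSNR]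

theorem halfLogSNR_mono {p p' q q' : ℝ} (hp : p ≤ p') (hq : q' ≤ q) :
    halfLogSNR p q ≤ halfLogSNR p' q' := by
  rw [halfLogSNR_eq_log_rpow, halfLogSNR_eq_log_rpow]
  gcongr

theorem halfLogSNR_mul_left {c : ℝ} (hc : 0 < c) (p q : ℝ) :
    halfLogSNR (c * p) (c * q) = halfLogSNR p q := by
  rw [halfLogSNR, halfLogSNR, ENNReal.ofReal_mul hc.le, ENNReal.ofReal_mul hc.le,
    ENNReal.mul_div_mul_left _ _ (by simpa using hc) ENNReal.ofReal_ne_top]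

theorem halfLogSNR_of_lt_one {x : ℝ} (h0 : 0 ≤ x) (h1 : x < 1) :
    halfLogSNR x (1 - x) = ((1 / 2 * Real.log (1 / (1 - x)) : ℝ) : EReal) := by
  have h : 0 < 1 - x := by linarith
  rw [halfLogSNR, ← ENNReal.ofReal_div_of_pos h, ← ENNReal.ofReal_one,
    ← ENNReal.ofReal_add zero_le_one (by positivity), ENNReal.log_ofReal_of_pos (by positivity),
    ← EReal.coe_mul]
  congr 3
  field_simp
  ring

theorem tendsto_halfLogSNR {α : Type*} {l : Filter α} {f h : α → ℝ} {p q : ℝ}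
    (hf : Tendsto f l (𝓝 p)) (hh : Tendsto h l (𝓝 q)) (hpq : 0 < p ∨ 0 < q) :
    Tendsto (fun x => halfLogSNR (f x) (h x)) l (𝓝 (halfLogSNR p q)) := by
  simp_rw [halfLogSNR_eq_log_rpow]
  refine (ENNReal.continuous_log.tendsto _).comp ((ENNReal.continuous_rpow_const.tendsto _).comp ?_)
  refine tendsto_const_nhds.add (ENNReal.Tendsto.div (ENNReal.tendsto_ofReal hf) ?_
    (ENNReal.tendsto_ofReal hh) ?_)
  · exact hpq.imp (fun h => by simpa using h) (fun h => by simpa using h)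
  · exact Or.inl ENNReal.ofReal_ne_top

end HalfLog

/-! ### The generalized mutual information -/

section GMI

variable {Es : ℝ≥0} {W : Kernel RSeq RSeq} {L : ℕ} {g : (Fin L → ℝ) → (Fin L → ℝ)}

theorem corrDelta_nonneg : 0 ≤ corrDelta Es W L g :=
  div_nonneg (sq_nonneg _) (mul_nonneg (by positivity) outPower_nonneg)

theorem corrDelta_le_one [IsMarkovKernel W] (hg : IsAdmissible Es W L g) :
    corrDelta Es W L g ≤ 1 :=
  div_le_one_of_le₀ (sq_crossCorr_le hg) (mul_nonneg (by positivity) outPower_nonneg)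

/-- The converse: no choice of `a` does better than `½ log (1 / (1 - Δ))`. -/
theorem gmi_le [IsMarkovKernel W] (hEs : 0 < Es) (hL : 1 ≤ L)
    (hT : Ergodic (pairShift^[L]) (jointLaw Es W)) (hg : IsAdmissible Es W L g) (a : ℝ) :
    gmi Es W L g a ≤ halfLogSNR (corrDelta Es W L g) (1 - corrDelta Es W L g) := by
  have hE' : (0 : ℝ) < Es := by exact_mod_cast hEs
  have hL' : (0 : ℝ) < L := by exact_mod_cast hL
  rcases (corrDelta_le_one hg).eq_or_lt with h1 | h1
  · rw [h1]; simp [halfLogSNR, EReal.coe_mul_top_of_pos]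
  have hΔ : crossCorr Es W L g ^ 2 / outPower Es W L g = L * Es * corrDelta Es W L g := by
    rw [corrDelta, ← mul_div_assoc, mul_div_mul_left _ _ (by positivity)]
  rw [halfLogSNR_of_lt_one corrDelta_nonneg h1]
  set Δ := corrDelta Es W L g
  refine sSup_le ?_
  rintro _ ⟨R, hR0, hR, rfl⟩
  rw [EReal.coe_le_coe_iff]
  by_contra! hlt
  obtain ⟨R', hR1, hR2⟩ := exists_between hlt
  obtain ⟨s, hs⟩ : ∃ s : ℝ≥0, (s : ℝ) = Es * Real.exp (-(2 * R')) :=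
    ⟨⟨Es * Real.exp (-(2 * R')), by positivity⟩, rfl⟩
  have hs0 : (0 : ℝ) < s := by rw [hs]; positivity
  have hexp : Real.exp (-(2 * R')) < 1 - Δ := by
    rw [← Real.lt_log_iff_exp_lt (by linarith)]
    rw [one_div (1 - Δ), Real.log_inv] at hR1
    linarith
  have hEs' : (Es : ℝ) / s = Real.exp (2 * R') := by
    rw [hs, Real.exp_neg]; field_simp
  refine not_isAchievable_of_lt hEs.ne' hL hT hg a (s := s) (by exact_mod_cast hs0.ne') ?_ ?_ hR
  · rw [hΔ, hs]
    have := mul_lt_mul_of_pos_left hexp (mul_pos hL' hE')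
    linarith
  · rw [hEs', Real.log_exp]; linarith

/-- The error exponent at `aOpt`, with the tilt parametrized by `u`. The second term vanishes at the
maximizer `u = Δ / (1 - Δ)`. -/
theorem isAchievable_aOpt_of_lt [IsMarkovKernel W] (hEs : 0 < Es) (hL : 1 ≤ L)
    (hT : Ergodic (pairShift^[L]) (jointLaw Es W)) (hg : IsAdmissible Es W L g) {R u : ℝ}
    (hΔ : 0 < corrDelta Es W L g) (hu : 0 ≤ u)
    (hR : R < 1 / 2 * Real.log (1 + u) +
      u / (2 * corrDelta Es W L g) * (1 / (1 + u) - (1 - corrDelta Es W L g))) :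
    IsAchievable Es W L g (aOpt Es W L g) R := by
  have hE' : (0 : ℝ) < Es := by exact_mod_cast hEs
  have hL' : (0 : ℝ) < L := by exact_mod_cast hL
  have hG0 : 0 < outPower Es W L g := by
    refine outPower_nonneg.lt_of_ne fun h => hΔ.ne' ?_
    rw [corrDelta, ← h, mul_zero, div_zero]
  have hC : crossCorr Es W L g ^ 2 = L * Es * outPower Es W L g * corrDelta Es W L g := by
    rw [corrDelta]; field_simp
  set Δ := corrDelta Es W L g
  set G := outPower Es W L g
  set C := crossCorr Es W L g
  have ha : aOpt Es W L g ^ 2 * (L * Es) = G * Δ := by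
    change (C / (L * Es)) ^ 2 * (L * Es) = _
    rw [div_pow, hC]; field_simp
  have haC : aOpt Es W L g * C = G * Δ := by
    change C / (L * Es) * C = _
    rw [div_mul_eq_mul_div, ← sq, hC]; field_simp
  have ht : 0 ≤ u * L / (2 * (G * Δ)) := by positivity
  refine isAchievable_of_lt hEs.ne' hT hg (t := u * L / (2 * (G * Δ))) (u := u) ht ?_ ?_
  · calc u = 2 * (u * L / (2 * (G * Δ))) * ((G * Δ) / L) := by field_simp
      _ = 2 * (u * L / (2 * (G * Δ))) * (aOpt Es W L g ^ 2 * Es) := by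
        rw [← ha]; field_simp
      _ = _ := by ring
  · have h := mul_lt_mul_of_pos_left hR hL'
    refine h.trans_eq ?_
    change _ = L / 2 * Real.log (1 + u) + u * L / (2 * (G * Δ)) * G / (1 + u) -
      u * L / (2 * (G * Δ)) * (G - 2 * aOpt Es W L g * C + aOpt Es W L g ^ 2 * (L * Es))
    rw [ha, mul_assoc 2, haC]
    field_simp
    ring

theorem zero_le_gmi [IsMarkovKernel W] (hg : Measurable g) (a : ℝ) : 0 ≤ gmi Es W L g a :=
  le_sSup ⟨0, le_rfl, isAchievable_zero hg a, rfl⟩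

theorem gmi_aOpt [IsMarkovKernel W] (hEs : 0 < Es) (hL : 1 ≤ L)
    (hT : Ergodic (pairShift^[L]) (jointLaw Es W)) (hg : IsAdmissible Es W L g) :
    gmi Es W L g (aOpt Es W L g) =
      halfLogSNR (corrDelta Es W L g) (1 - corrDelta Es W L g) := by
  refine le_antisymm (gmi_le hEs hL hT hg _) ?_
  rcases corrDelta_nonneg.eq_or_lt with h0 | h0
  · rw [← h0]
    refine le_trans (le_of_eq ?_) (zero_le_gmi hg.1 _)
    simp [halfLogSNR]
  refine le_of_forall_lt_imp_le_of_dense fun c hc => ?_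
  rcases lt_or_ge c 0 with hc0 | hc0
  · exact hc0.le.trans (zero_le_gmi hg.1 _)
  lift c to ℝ using ⟨hc.ne_top, (EReal.bot_lt_zero.trans_le hc0).ne'⟩
  have hc0' : 0 ≤ c := by exact_mod_cast hc0
  refine le_sSup ⟨c, hc0', ?_, rfl⟩
  rcases (corrDelta_le_one hg).eq_or_lt with h1 | h1
  · -- A noiseless observation: the exponent `½ log (1 + u)` is unbounded in `u`.
    refine isAchievable_aOpt_of_lt hEs hL hT hg (u := Real.exp (2 * c)) h0 (Real.exp_pos _).le ?_
    rw [h1]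
    have h2 : 2 * c < Real.log (1 + Real.exp (2 * c)) := by
      rw [Real.lt_log_iff_exp_lt (by positivity)]; linarith
    have h3 : 0 ≤ Real.exp (2 * c) / (2 * 1) * (1 / (1 + Real.exp (2 * c)) - (1 - 1)) := by
      rw [sub_self, sub_zero]; positivity
    linarith
  · have h2 : 0 < 1 - corrDelta Es W L g := by linarith
    rw [halfLogSNR_of_lt_one h0.le h1, EReal.coe_lt_coe_iff] at hc
    refine isAchievable_aOpt_of_lt hEs hL hT hg
      (u := corrDelta Es W L g / (1 - corrDelta Es W L g)) h0 (by positivity) ?_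
    have h3 : 1 + corrDelta Es W L g / (1 - corrDelta Es W L g) =
        1 / (1 - corrDelta Es W L g) := by field_simp; ring
    rw [h3, one_div_one_div, sub_self, mul_zero, add_zero]
    exact hc

end GMI

/-! ### The conditional mean as optimal output mapping -/

section MMSE

variable {Es : ℝ≥0} {W : Kernel RSeq RSeq} {L : ℕ} {g : (Fin L → ℝ) → (Fin L → ℝ)}

theorem measurable_firstOutput (L : ℕ) :
    Measurable fun ω : RSeq × RSeq => superSymbol L 0 ω.2 :=
  (measurable_superSymbol L 0).comp measurable_snd

theorem outputSigma_le (L : ℕ) :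
    outputSigma L ≤ (inferInstance : MeasurableSpace (RSeq × RSeq)) :=
  (measurable_firstOutput L).comap_le

theorem stronglyMeasurable_condMean (l : Fin L) :
    StronglyMeasurable[outputSigma L] (condMean Es W L l) :=
  stronglyMeasurable_condExp

theorem memLp_condMean [IsMarkovKernel W] (l : Fin L) :
    MemLp (condMean Es W L l) 2 (jointLaw Es W) :=
  (memLp_input l).condExp one_le_two

theorem exists_isMMSEEstimator (Es : ℝ≥0) (W : Kernel RSeq RSeq) (L : ℕ) :
    ∃ g : (Fin L → ℝ) → (Fin L → ℝ), IsMMSEEstimator Es W L g := by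
  have h : ∀ l : Fin L, ∃ h : (Fin L → ℝ) → ℝ, StronglyMeasurable h ∧
      condMean Es W L l = h ∘ fun ω : RSeq × RSeq => superSymbol L 0 ω.2 := fun l =>
    (stronglyMeasurable_condMean l).exists_eq_measurable_comp
  choose φ hφ hφ' using h
  refine ⟨fun y l => φ l y, measurable_pi_iff.2 fun l => (hφ l).measurable, fun l => ?_⟩
  rw [hφ' l]
  rfl

theorem IsMMSEEstimator.isAdmissible [IsMarkovKernel W] (hg : IsMMSEEstimator Es W L g) :
    IsAdmissible Es W L g :=
  ⟨hg.1, fun l => (memLp_congr_ae (hg.2 l)).2 (memLp_condMean l)⟩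

theorem integral_input_mul_eq [IsMarkovKernel W] (l : Fin L) {f : RSeq × RSeq → ℝ}
    (hf : StronglyMeasurable[outputSigma L] f) (hf2 : MemLp f 2 (jointLaw Es W)) :
    ∫ ω : RSeq × RSeq, superSymbol L 0 ω.1 l * f ω ∂(jointLaw Es W) =
      ∫ ω, condMean Es W L l ω * f ω ∂(jointLaw Es W) := by
  have hi : Integrable (fun ω : RSeq × RSeq => superSymbol L 0 ω.1 l) (jointLaw Es W) :=
    (memLp_input l).integrable one_le_two
  have h := condExp_mul_of_stronglyMeasurable_right (μ := jointLaw Es W) hf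
    ((memLp_input (Es := Es) (W := W) l).integrable_mul hf2) hi
  rw [← integral_condExp (outputSigma_le L)]
  exact integral_congr_ae h

/-- `E‖E[x|y]‖²`. -/
noncomputable def condPower (Es : ℝ≥0) (W : Kernel RSeq RSeq) (L : ℕ) : ℝ :=
  ∫ ω, ∑ l : Fin L, condMean Es W L l ω ^ 2 ∂(jointLaw Es W)

theorem integral_input_mul_condMean [IsMarkovKernel W] (l : Fin L) :
    ∫ ω : RSeq × RSeq, superSymbol L 0 ω.1 l * condMean Es W L l ω ∂(jointLaw Es W) =
      ∫ ω, condMean Es W L l ω ^ 2 ∂(jointLaw Es W) := by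
  rw [integral_input_mul_eq l (stronglyMeasurable_condMean l) (memLp_condMean l)]
  simp_rw [sq]

theorem crossCorr_eq_integral_condMean [IsMarkovKernel W] (hg : IsAdmissible Es W L g) :
    crossCorr Es W L g =
      ∫ ω, ∑ l : Fin L, condMean Es W L l ω * g (superSymbol L 0 ω.2) l ∂(jointLaw Es W) := by
  have hm : ∀ l : Fin L, StronglyMeasurable[outputSigma L]
      fun ω : RSeq × RSeq => g (superSymbol L 0 ω.2) l := fun l =>
    (((measurable_pi_apply l).comp hg.1).comp (comap_measurable _)).stronglyMeasurable
  have i1 : ∀ l : Fin L, Integrable (fun ω : RSeq × RSeq =>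
      superSymbol L 0 ω.1 l * g (superSymbol L 0 ω.2) l) (jointLaw Es W) := fun l =>
    (memLp_input l).integrable_mul (hg.2 l)
  have i2 : ∀ l : Fin L, Integrable (fun ω : RSeq × RSeq =>
      condMean Es W L l ω * g (superSymbol L 0 ω.2) l) (jointLaw Es W) := fun l =>
    (memLp_condMean l).integrable_mul (hg.2 l)
  rw [crossCorr, integral_finsetSum _ fun l _ => i1 l, integral_finsetSum _ fun l _ => i2 l]
  exact Finset.sum_congr rfl fun l _ => integral_input_mul_eq l (hm l) (hg.2 l)

theorem IsMMSEEstimator.outPower_eq [IsMarkovKernel W] (hg : IsMMSEEstimator Es W L g) :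
    outPower Es W L g = condPower Es W L := by
  refine integral_congr_ae ?_
  filter_upwards [ae_all_iff.2 hg.2] with ω hω
  simp [hω]

theorem IsMMSEEstimator.crossCorr_eq [IsMarkovKernel W] (hg : IsMMSEEstimator Es W L g) :
    crossCorr Es W L g = condPower Es W L := by
  rw [crossCorr_eq_integral_condMean hg.isAdmissible]
  refine integral_congr_ae ?_
  filter_upwards [ae_all_iff.2 hg.2] with ω hω
  simp [hω, sq]

theorem IsMMSEEstimator.corrDelta_eq [IsMarkovKernel W] (hg : IsMMSEEstimator Es W L g) :
    corrDelta Es W L g = condPower Es W L / (L * Es) := by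
  rw [corrDelta, hg.outPower_eq, hg.crossCorr_eq]
  rcases eq_or_ne (condPower Es W L) 0 with h | h
  · simp [h]
  · rw [sq, mul_div_mul_right _ _ h]

theorem condPower_nonneg : 0 ≤ condPower Es W L :=
  integral_nonneg fun _ => Finset.sum_nonneg fun _ _ => sq_nonneg _

theorem sum_variance_condMean [IsMarkovKernel W] :
    ∑ l : Fin L, variance (condMean Es W L l) (jointLaw Es W) = condPower Es W L := by
  rw [condPower, integral_finsetSum _ fun l _ => (memLp_condMean l).integrable_sq]
  refine Finset.sum_congr rfl fun l _ => ?_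
  have h : ∫ ω, condMean Es W L l ω ∂(jointLaw Es W) = 0 :=
    (integral_condExp (outputSigma_le L)).trans (integral_input l)
  rw [variance_of_integral_eq_zero (memLp_condMean l).1.aemeasurable h]

/-- The conditional mean maximizes `Δ`, by Cauchy–Schwarz in `L²(σ(y))`. -/
theorem corrDelta_le_condPower [IsMarkovKernel W] (hg : IsAdmissible Es W L g) :
    corrDelta Es W L g ≤ condPower Es W L / (L * Es) := by
  have h : crossCorr Es W L g ^ 2 ≤ condPower Es W L * outPower Es W L g := by
    rw [crossCorr_eq_integral_condMean hg]
    exact sq_integral_sum_mul_le memLp_condMean hg.2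
  have hG : 0 ≤ outPower Es W L g := outPower_nonneg
  rw [corrDelta, mul_comm, ← div_div]
  gcongr
  exact div_le_of_le_mul₀ hG condPower_nonneg h

theorem blockMMSE_eq [IsMarkovKernel W] (hL : 1 ≤ L) :
    blockMMSE Es W L = Es - condPower Es W L / L := by
  have hL' : (L : ℝ) ≠ 0 := by positivity
  have he : ∀ l : Fin L, ∫ ω : RSeq × RSeq, (superSymbol L 0 ω.1 l - condMean Es W L l ω) ^ 2
      ∂(jointLaw Es W) = Es - ∫ ω, condMean Es W L l ω ^ 2 ∂(jointLaw Es W) := by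
    intro l
    have i1 := (memLp_input (Es := Es) (W := W) l).integrable_sq
    have i2 := (memLp_condMean (Es := Es) (W := W) l).integrable_sq
    have i3 : Integrable (fun ω : RSeq × RSeq => superSymbol L 0 ω.1 l * condMean Es W L l ω)
      (jointLaw Es W) := (memLp_input l).integrable_mul (memLp_condMean l)
    have : ∀ ω : RSeq × RSeq, (superSymbol L 0 ω.1 l - condMean Es W L l ω) ^ 2 =
        superSymbol L 0 ω.1 l ^ 2 - 2 * (superSymbol L 0 ω.1 l * condMean Es W L l ω) +
          condMean Es W L l ω ^ 2 := fun ω => by ring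
    simp_rw [this]
    rw [integral_add (f := fun ω : RSeq × RSeq => superSymbol L 0 ω.1 l ^ 2 -
        2 * (superSymbol L 0 ω.1 l * condMean Es W L l ω)) (i1.sub (i3.const_mul 2)) i2,
      integral_sub i1 (i3.const_mul 2), integral_const_mul, integral_input_mul_condMean,
      integral_input_sq]
    ring
  have hi : ∀ l : Fin L, Integrable (fun ω : RSeq × RSeq =>
      (superSymbol L 0 ω.1 l - condMean Es W L l ω) ^ 2) (jointLaw Es W) := fun l =>
    ((memLp_input l).sub (memLp_condMean l)).integrable_sq
  rw [blockMMSE, integral_finsetSum _ fun l _ => hi l]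
  simp only [he]
  rw [Finset.sum_sub_distrib, condPower,
    integral_finsetSum _ fun l _ => (memLp_condMean l).integrable_sq]
  simp only [Finset.sum_const, Finset.card_univ, Fintype.card_fin, nsmul_eq_mul]
  field_simp

theorem gmiOpt_eq [IsMarkovKernel W] (hEs : 0 < Es) (hL : 1 ≤ L)
    (hT : Ergodic (pairShift^[L]) (jointLaw Es W)) (hg : IsMMSEEstimator Es W L g) :
    gmiOpt Es W L = halfLogSNR (corrDelta Es W L g) (1 - corrDelta Es W L g) := by
  refine le_antisymm (sSup_le ?_) ?_
  · rintro _ ⟨g', a, hg', rfl⟩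
    have h := (corrDelta_le_condPower hg').trans_eq hg.corrDelta_eq.symm
    exact (gmi_le hEs hL hT hg' a).trans (halfLogSNR_mono h (by linarith))
  · rw [← gmi_aOpt hEs hL hT hg.isAdmissible]
    exact le_sSup ⟨g, _, hg.isAdmissible, rfl⟩

theorem gmiOpt_eq_blockMMSE [IsMarkovKernel W] (hEs : 0 < Es) (hL : 1 ≤ L)
    (hT : Ergodic (pairShift^[L]) (jointLaw Es W)) :
    gmiOpt Es W L = halfLogSNR ((Es : ℝ) - blockMMSE Es W L) (blockMMSE Es W L) := by
  obtain ⟨g, hg⟩ := exists_isMMSEEstimator Es W L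
  have hE' : (0 : ℝ) < Es := by exact_mod_cast hEs
  have hL' : (0 : ℝ) < L := by exact_mod_cast hL
  rw [gmiOpt_eq hEs hL hT hg, blockMMSE_eq hL, hg.corrDelta_eq, ← halfLogSNR_mul_left hE']
  congr 1 <;> field_simp
  ring

end MMSE

theorem proposition5 (Es : ℝ≥0) (hEs : 0 < Es) (W : Kernel RSeq RSeq) [IsMarkovKernel W]
    (hW : ∀ L : ℕ, 1 ≤ L → Ergodic (pairShift^[L]) (jointLaw Es W)) :
    (∀ L : ℕ, 1 ≤ L →
      (∀ g : (Fin L → ℝ) → (Fin L → ℝ), IsAdmissible Es W L g →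
        (∀ a : ℝ, gmi Es W L g a ≤ gmi Es W L g (aOpt Es W L g)) ∧
        gmi Es W L g (aOpt Es W L g) =
          halfLogSNR (corrDelta Es W L g) (1 - corrDelta Es W L g)) ∧
      (∃ g : (Fin L → ℝ) → (Fin L → ℝ), IsMMSEEstimator Es W L g) ∧
      (∀ g : (Fin L → ℝ) → (Fin L → ℝ), IsMMSEEstimator Es W L g →
        IsAdmissible Es W L g ∧
        corrDelta Es W L g =
          (∑ l : Fin L, variance (condMean Es W L l) (jointLaw Es W)) / ((L : ℝ) * (Es : ℝ)) ∧
        (∀ g' : (Fin L → ℝ) → (Fin L → ℝ), IsAdmissible Es W L g' →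
          corrDelta Es W L g' ≤ corrDelta Es W L g) ∧
        gmi Es W L g (aOpt Es W L g) = gmiOpt Es W L) ∧
      gmiOpt Es W L = halfLogSNR ((Es : ℝ) - blockMMSE Es W L) (blockMMSE Es W L)) ∧
    (∀ mmse : ℝ, Tendsto (fun L : ℕ => blockMMSE Es W L) atTop (𝓝 mmse) →
      Tendsto (fun L : ℕ => gmiOpt Es W L) atTop (𝓝 (halfLogSNR ((Es : ℝ) - mmse) mmse))) := by
  refine ⟨fun L hL => ⟨fun g hg => ⟨fun a => ?_, gmi_aOpt hEs hL (hW L hL) hg⟩,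
    exists_isMMSEEstimator Es W L, fun g hg => ⟨hg.isAdmissible, ?_, fun g' hg' => ?_, ?_⟩,
    gmiOpt_eq_blockMMSE hEs hL (hW L hL)⟩, fun mmse hm => ?_⟩
  · rw [gmi_aOpt hEs hL (hW L hL) hg]
    exact gmi_le hEs hL (hW L hL) hg a
  · rw [hg.corrDelta_eq, sum_variance_condMean]
  · rw [hg.corrDelta_eq]
    exact corrDelta_le_condPower hg'
  · rw [gmiOpt_eq hEs hL (hW L hL) hg, gmi_aOpt hEs hL (hW L hL) hg.isAdmissible]
  · have hE' : (0 : ℝ) < Es := by exact_mod_cast hEs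
    have hpq : 0 < (Es : ℝ) - mmse ∨ 0 < mmse := by
      by_contra! h
      linarith
    refine (tendsto_halfLogSNR (tendsto_const_nhds.sub hm) hm hpq).congr' ?_
    filter_upwards [eventually_ge_atTop 1] with L hL
    exact (gmiOpt_eq_blockMMSE hEs hL (hW L hL)).symm
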